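/- **Conventions.** A (Lebesgue) measurable function $f$ on $(0,\infty)$ that is positive for all large arguments is *regularly varying at $\infty$ with index $\rho\in\mathbb R$*, written $f\in\mathcal R_\rho(\infty)$, if $\lim_{x\to\infty} f(\lambda x)/f(x)=\lambda^{\rho}$ for every $\lambda>0$; and $f\in\mathcal R_\rho(0+)$ means $f(1/\cdot)\in\mathcal R_{-\rho}(\infty)$. Let $L=(L_t)_{t\in\mathbb R}$ be a Lévy process with $EL_1=0$ and $EL_1^2=\sigma^2\in(0,\infty)$ or, more generally, a process with square integrable, mean-zero, orthogonal increments with $E(L_t-L_s)^2=\sigma^2(t-s)$ for $s\le t$. Let $g:\mathbb R\to\mathbb R$ be square integrable, zero on $(-\infty,0]$, and such that the Fourier transform $\tilde g(\omega)=\int_{-\infty}^{\infty}e^{i\omega t}g(t)\,dt:=\lim_{T\to\infty}\int_{-T}^{T}e^{i\omega t}g(t)\,dt$ is non-zero at every complex $\omega$ with $\operatorname{Im}\omega\ge 0$ at which this limit exists. Let $Y_t=\int_{-\infty}^{\infty}g(t-s)\,dL_s$, $t\in\mathbb R$ (integral in the $L^2$-sense), be the CMA process with kernel $g$. A *spectral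 density* of $Y$ is a nonnegative integrable function $f$ on $\mathbb R$ with $\operatorname{Cov}(Y_{t+h},Y_t)=\int_{-\infty}^{\infty}e^{i\omega h}f(\omega)\,d\omega$ for all $t,h\in\mathbb R$. **Proposition.** Let $\nu>1/2$ and $g\in\mathcal R_{\nu-1}(0+)$. Write $g^{(-1)}(t):=\int_0^t g(s)\,ds$ and $h:=g^{(\lfloor\nu-1\rfloor)}$, and suppose that the derivative $h$ exists on $(0,\infty)$ (no condition if $\lfloor\nu-1\rfloor\le 0$). Assume: * **(A1)** $g^{(\lfloor\nu\rfloor)}$ exists on some interval $(0,\delta)$ and has a finite or infinite limit $g^{(\lfloor\nu\rfloor)}(0+)\ne 0$; * **(A2)** $h\in\mathcal R_\alpha(0+)$ for some $\alpha\in[0,1)$; * **(A3)** for some $x_0>0$ such that $h\ne0$ on $(0,x_0]$, the function $$q(u):=\sup_{0<x\le x_0}\ \sup_{0\le w\le v\le 1}\left|\frac{h((u+v+w)x)-h((u+v)x)-h((u+w)x)+h(ux)}{h(x)}\right|$$ is bounded and integrable on $[1,\infty)$. Then the limit defining $\tilde g(\omega)$ exists for every real $\omega\neq0$; the function $f_Y(\omega)=\frac{\sigma^2}{2\pi}|\tilde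 g(\omega)|^2$ ($\omega\in\mathbb R\setminus\{0\}$) is a spectral density of $Y$ and is strictly positive; and $$f_Y(|\cdot|)\in\mathcal R_{-2\nu}(\infty).$$ -/

import Mathlib

open MeasureTheory ProbabilityTheory Filter Topology Set

noncomputable section

/-- `f` is regularly varying at `∞` with index `ρ`: it is (Lebesgue) measurable on `(0,∞)`,
positive for all large arguments, and `f (λ x) / f x → λ ^ ρ` as `x → ∞` for every `λ > 0`. -/
structure RegVarAtTop (f : ℝ → ℝ) (ρ : ℝ) : Prop where
  aemeasurable : AEMeasurable f (volume.restrict (Ioi 0))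
  eventually_pos : ∀ᶠ x in atTop, 0 < f x
  tendsto_ratio : ∀ l : ℝ, 0 < l → Tendsto (fun x => f (l * x) / f x) atTop (𝓝 (l ^ ρ))

/-- `f` is regularly varying at `0+` with index `ρ`: `x ↦ f (1 / x)` is regularly varying at `∞`
with index `-ρ`. -/
def RegVarAtZero (f : ℝ → ℝ) (ρ : ℝ) : Prop :=
  RegVarAtTop (fun x => f (1 / x)) (-ρ)

/-- The truncated Fourier integral `∫_{-T}^{T} e^{iωt} g(t) dt` at a complex frequency `ω`. -/
def truncFourier (g : ℝ → ℝ) (ω : ℂ) (T : ℝ) : ℂ :=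
  ∫ t in (-T)..T, Complex.exp (Complex.I * ω * (t : ℂ)) * (g t : ℂ)

/-- The integral `∫_{-∞}^{∞} e^{iωt} g(t) dt` converges, possibly only conditionally, to `z`. -/
def HasFourierValue (g : ℝ → ℝ) (ω z : ℂ) : Prop :=
  Tendsto (truncFourier g ω) atTop (𝓝 z)

/-- The Fourier transform `∫_{-∞}^{∞} e^{iωt} g(t) dt`, as an improper integral; it is meaningful
only at those `ω` at which the integral converges. -/
def kernelFourier (g : ℝ → ℝ) (ω : ℂ) : ℂ :=
  limUnder atTop (truncFourier g ω)

/-- Kernels of causal continuous-time moving averages: square integrable, zero on `(-∞, 0]`, and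
with the minimum phase property, i.e. the Fourier transform does not vanish on the closed upper
half plane (wherever the Fourier integral converges). -/
structure IsCMAKernel (g : ℝ → ℝ) : Prop where
  memLp : MemLp g 2 volume
  causal : ∀ t : ℝ, t ≤ 0 → g t = 0
  minimum_phase : ∀ ω : ℂ, 0 ≤ ω.im → ¬ HasFourierValue g ω 0

variable {Ω : Type*} [MeasurableSpace Ω]

/-- `L` is a mean-zero second-order process with stationary orthogonal increments and
`E (L_t - L_s)² = σ² (t - s)`.  Every Lévy process with `E L_1 = 0` and `E L_1² = σ² < ∞` is one. -/
structure IsOrthogonalNoise (P : Measure Ω) (L : ℝ → Ω → ℝ) (σ : ℝ) : Prop where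
  memLp : ∀ s t : ℝ, MemLp (fun x => L t x - L s x) 2 P
  mean_zero : ∀ s t : ℝ, ∫ x, (L t x - L s x) ∂P = 0
  second_moment : ∀ s t : ℝ, s ≤ t → ∫ x, (L t x - L s x) ^ 2 ∂P = σ ^ 2 * (t - s)
  orthogonal : ∀ s t u v : ℝ, s ≤ t → t ≤ u → u ≤ v →
    ∫ x, (L t x - L s x) * (L v x - L u x) ∂P = 0

/-- `Z = ∫ f dL` in the `L²` sense: `Z` is square integrable and there are step functions
`∑ cᵢ 1_{(aᵢ, bᵢ]}` arbitrarily close to `f` in `L²(ℝ)` whose elementary integrals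
`∑ cᵢ (L_{bᵢ} - L_{aᵢ})` are arbitrarily close to `Z` in `L²(P)`.  If `L` has stationary orthogonal
increments, then by the isometry property such a `Z` is unique up to null sets. -/
def IsL2Integral (P : Measure Ω) (L : ℝ → Ω → ℝ) (f : ℝ → ℝ) (Z : Ω → ℝ) : Prop :=
  MemLp Z 2 P ∧ ∀ ε : ℝ, 0 < ε → ∃ (m : ℕ) (a b c : Fin m → ℝ), (∀ i, a i ≤ b i) ∧
    eLpNorm (fun s => f s - ∑ i, c i * (Ioc (a i) (b i)).indicator (fun _ => (1 : ℝ)) s) 2 volume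
      ≤ ENNReal.ofReal ε ∧
    eLpNorm (fun x => Z x - ∑ i, c i * (L (b i) x - L (a i) x)) 2 P ≤ ENNReal.ofReal ε

/-- `Y_t = ∫ g(t - s) dL_s` for all `t`. -/
def IsCMAProcess (P : Measure Ω) (L : ℝ → Ω → ℝ) (g : ℝ → ℝ) (Y : ℝ → Ω → ℝ) : Prop :=
  ∀ t : ℝ, IsL2Integral P L (fun s => g (t - s)) (Y t)

/-- `f` is a spectral density of the weakly stationary process `Y`: it is nonnegative and
integrable and `Cov (Y_{t+h}, Y_t) = ∫ e^{iωh} f(ω) dω` for all `t` and `h`. -/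
structure IsSpectralDensity (P : Measure Ω) (Y : ℝ → Ω → ℝ) (f : ℝ → ℝ) : Prop where
  nonneg : ∀ ω : ℝ, 0 ≤ f ω
  integrable : Integrable f volume
  autocovariance : ∀ t h : ℝ,
    ((covariance (Y (t + h)) (Y t) P : ℝ) : ℂ) =
      ∫ ω : ℝ, Complex.exp (Complex.I * (ω : ℂ) * (h : ℂ)) * (f ω : ℂ)

/-- The function `f_Y(ω) = σ² / (2π) |g̃(ω)|²`. -/
def cmaSpectralDensity (σ : ℝ) (g : ℝ → ℝ) (ω : ℝ) : ℝ :=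
  σ ^ 2 / (2 * Real.pi) * ‖kernelFourier g (ω : ℂ)‖ ^ 2

/-- `g^{(m)}` for an integer `m ≥ -1`, with `g^{(-1)}(t) = ∫_0^t g(s) ds`. -/
def kernelDeriv (g : ℝ → ℝ) (m : ℤ) (t : ℝ) : ℝ :=
  if m < 0 then ∫ s in (0 : ℝ)..t, g s else iteratedDeriv m.toNat g t

/-- The derivatives of `g` at `t` up to order `m` exist (no condition if `m ≤ 0`). -/
def HasDerivsAt (g : ℝ → ℝ) (m : ℤ) (t : ℝ) : Prop :=
  ∀ k : ℕ, (k : ℤ) < m → DifferentiableAt ℝ (iteratedDeriv k g) t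

/-- `g^{(m)}` exists near `0+` and has there a finite or infinite limit that is not zero. -/
def NonzeroDerivAtZero (g : ℝ → ℝ) (m : ℤ) : Prop :=
  (∀ᶠ t in 𝓝[>] (0 : ℝ), HasDerivsAt g m t) ∧
    ∃ l : EReal, l ≠ 0 ∧ Tendsto (fun t => (kernelDeriv g m t : EReal)) (𝓝[>] 0) (𝓝 l)

/-- The function `q(u)`: the supremum over `0 < x ≤ x₀` and `0 ≤ w ≤ v ≤ 1` of
`|(h((u+v+w)x) - h((u+v)x) - h((u+w)x) + h(ux)) / h(x)|`, with values in `[0, ∞]`. -/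
def secondDiffSup (h : ℝ → ℝ) (x₀ u : ℝ) : ENNReal :=
  ⨆ (x : ℝ) (v : ℝ) (w : ℝ) (_ : 0 < x ∧ x ≤ x₀ ∧ 0 ≤ w ∧ w ≤ v ∧ v ≤ 1),
    ENNReal.ofReal
      |(h ((u + v + w) * x) - h ((u + v) * x) - h ((u + w) * x) + h (u * x)) / h x|

/-- For some `x₀ > 0` (with `h` nonvanishing on `(0, x₀]`) the function `q` is bounded and
integrable on `[1, ∞)`. -/
def SecondDiffCondition (h : ℝ → ℝ) : Prop :=
  ∃ x₀ : ℝ, 0 < x₀ ∧ (∀ x : ℝ, 0 < x → x ≤ x₀ → h x ≠ 0) ∧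
    (∃ C : NNReal, ∀ u : ℝ, 1 ≤ u → secondDiffSup h x₀ u ≤ C) ∧
    AEMeasurable (secondDiffSup h x₀) (volume.restrict (Ici 1)) ∧
    ∫⁻ u in Ici (1 : ℝ), secondDiffSup h x₀ u < ⊤

end

/-! A forward difference with step `x` multiplies the Fourier transform by `e^{-iωx} - 1`, and at
the frequency `ω = π / x` this factor is exactly `-2`. A finite difference of high enough order is
integrable even when `g` is only square integrable, so convergence of the Fourier integral of `g` at
any `ω ≠ 0` follows by dividing by the nonzero factor for a small step `x`. The translation errors
are integrals over windows of fixed length, which vanish at infinity because `g` is in `L²`.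

For the asymptotics take `ω = π / x` and substitute `t = u x`. If the `n`-th differences satisfy
`|Δ_x^n g(ux)| ≤ g(x) Q(u)` for `u ≥ 1` with `Q` integrable, then `(-2)^n g̃(π/x) / (x g(x))` is the
integral of `e^{iπu} Δ_x^n g(ux) / g(x)`, and dominated convergence (Potter's bounds for `u < 1`,
`Q` for `u ≥ 1`) replaces `g(ux) / g(x)` by the truncated power of exponent `ν - 1`. The limit
constant is nonzero by the Gamma integral and Abel regularization. Hence `|g̃(ω)|` is asymptotic to
a constant times `(π/ω) g(π/ω)`, whose square has index `-2ν`. See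
`RegVarAtZero.tendsto_integral_fwdDiff` and `RegVarAtZero.fourier_asymptotics`.

The domination comes from (A3) at `v = w = 1`. If `k = ⌊ν - 1⌋ ≥ 0`, integrating the bound on the
second differences of `g^{(k)}` over windows `k` times bounds the differences of `g` of order `k +
2` by `x^k |g^{(k)}(x)|` times an integrable function, and a mean value argument gives `x^k
|g^{(k)}(x)| ≤ C g(x)`. If `ν < 1`, the same scheme is applied to the primitive of `g`; integration
by parts and Karamata's theorem lead back to `g`.

The spectral representation is the `L²` isometry of the stochastic integral combined with Parseval's
identity, and positivity is the minimum phase property. -/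

/-! ### Truncated Fourier integrals, translations and finite differences -/

/-- The integrals of a square integrable function over windows of fixed length vanish at infinity. -/
theorem tendsto_integral_window_of_memLp_two {φ : ℝ → ℝ} (hφ : MemLp φ 2 volume) (x : ℝ)
    {l : Filter ℝ} (hl : l ≤ cocompact ℝ) :
    Tendsto (fun T => ∫ t in Set.uIoc T (T + x), |φ t|) l (𝓝 0) := by
  have hsq : Integrable (fun t => φ t ^ 2) := hφ.integrable_sq
  have hloc : LocallyIntegrable φ := hφ.locallyIntegrable (by norm_num)
  have hint : ∀ T, IntegrableOn (fun t => |φ t|) (Set.uIoc T (T + x)) := fun T =>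
    ((hloc.integrableOn_isCompact isCompact_uIcc).mono_set uIoc_subset_uIcc).norm
  -- the windows of the squares
  have hsqw : Tendsto (fun T => ∫ t in Set.uIoc T (T + x), φ t ^ 2) l (𝓝 0) := by
    have : ∀ T, ∫ t in Set.uIoc T (T + x), φ t ^ 2
        = ∫ t, (Set.uIoc T (T + x)).indicator (fun t => φ t ^ 2) t := fun T =>
      (integral_indicator measurableSet_uIoc).symm
    simp_rw [this]
    rw [← integral_zero ℝ ℝ (μ := volume)]
    have hl' : Tendsto (fun T : ℝ => |T|) (cocompact ℝ) atTop := tendsto_norm_cocompact_atTop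
    have main : Tendsto (fun T => ∫ t, (Set.uIoc T (T + x)).indicator (fun t => φ t ^ 2) t)
        (cocompact ℝ) (𝓝 (∫ _ : ℝ, (0 : ℝ))) := by
      have : (cocompact ℝ).IsCountablyGenerated := by
        rw [cocompact_eq_atBot_atTop]; infer_instance
      refine tendsto_integral_filter_of_dominated_convergence (fun t => φ t ^ 2) ?_ ?_ hsq ?_
      · exact Eventually.of_forall fun T => hsq.aestronglyMeasurable.indicator measurableSet_uIoc
      · refine Eventually.of_forall fun T => Eventually.of_forall fun t => ?_
        refine (norm_indicator_le_norm_self _ _).trans ?_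
        simp
      · refine Eventually.of_forall fun t => ?_
        refine tendsto_const_nhds.congr' ?_
        -- As soon as `|T| > |t| + |x|`, the window between `T` and `T + x` misses `t`.
        filter_upwards [hl'.eventually_gt_atTop (|t| + |x|)] with T hT
        rw [indicator_of_notMem]
        intro hmem
        have := uIoc_subset_uIcc hmem
        have h2 := Set.abs_sub_left_of_mem_uIcc this
        have h3 := abs_sub_abs_le_abs_sub T t
        rw [abs_sub_comm] at h3
        have : |T + x - T| = |x| := by congr 1; ring
        linarith
    exact main.mono_left hl
  rw [Metric.tendsto_nhds]
  intro ε hε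
  -- The bound `|φ| ≤ c + φ² / c` replaces Cauchy–Schwarz; this `c` makes the constant part `c |x|`
  -- at most `ε / 2`, and the `+ 1` covers `x = 0`.
  set c : ℝ := ε / (2 * (|x| + 1)) with hc
  have hx1 : 0 < |x| + 1 := by positivity
  have hcpos : 0 < c := by positivity
  have hkey : ∀ T, ∫ t in Set.uIoc T (T + x), |φ t|
      ≤ c * |x| + c⁻¹ * ∫ t in Set.uIoc T (T + x), φ t ^ 2 := by
    intro T
    have hfin : volume (Set.uIoc T (T + x)) < ⊤ := by
      rw [Set.uIoc]; exact measure_Ioc_lt_top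
    have hcst : Integrable (fun _ : ℝ => c) (volume.restrict (Set.uIoc T (T + x))) :=
      integrableOn_const (hs := hfin.ne)
    have h1 : ∫ t in Set.uIoc T (T + x), |φ t|
        ≤ ∫ t in Set.uIoc T (T + x), (c + c⁻¹ * φ t ^ 2) := by
      refine integral_mono (hint T) ?_ ?_
      · exact hcst.add (hsq.integrableOn.const_mul _)
      · intro t
        simp only
        have : c⁻¹ * φ t ^ 2 + c - |φ t| = c⁻¹ * ((|φ t| - c / 2) ^ 2 + 3 / 4 * c ^ 2) := by
          rw [← sq_abs]; field_simp; ring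
        have h2 : 0 ≤ c⁻¹ * ((|φ t| - c / 2) ^ 2 + 3 / 4 * c ^ 2) := by positivity
        linarith
    refine h1.trans (le_of_eq ?_)
    rw [integral_add hcst (hsq.integrableOn.const_mul _),
      integral_const_mul, setIntegral_const, smul_eq_mul, mul_comm]
    congr 2
    simp [Measure.real, Set.uIoc, Real.volume_Ioc, max_sub_min_eq_abs]
  have hev := (Metric.tendsto_nhds.1 hsqw) (c * (ε / 2)) (by positivity)
  filter_upwards [hev] with T hT
  rw [Real.dist_eq, sub_zero] at hT ⊢
  rw [abs_of_nonneg (integral_nonneg fun t => by positivity)] at hT ⊢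
  have h4 : c⁻¹ * ∫ t in Set.uIoc T (T + x), φ t ^ 2 < ε / 2 := by
    rw [inv_mul_lt_iff₀ hcpos]; exact hT
  have h5 : c * |x| ≤ ε / 2 := by
    rw [hc, div_mul_eq_mul_div, div_le_div_iff₀ (by positivity) (by norm_num)]
    nlinarith [abs_nonneg x]
  linarith [hkey T]

theorem norm_cexp_I_mul (ω t : ℝ) : ‖Complex.exp (Complex.I * (ω : ℂ) * (t : ℂ))‖ = 1 := by
  rw [show Complex.I * (ω : ℂ) * (t : ℂ) = ((ω * t : ℝ) : ℂ) * Complex.I by push_cast; ring,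
    Complex.norm_exp_ofReal_mul_I]

theorem intervalIntegrable_cexp_mul {φ : ℝ → ℝ} (hφ : LocallyIntegrable φ) (ω : ℂ) (a b : ℝ) :
    IntervalIntegrable (fun t => Complex.exp (Complex.I * ω * (t : ℂ)) * (φ t : ℂ)) volume a b := by
  have h : IntervalIntegrable (fun t => (φ t : ℂ)) volume a b :=
    ⟨((hφ.integrableOn_isCompact isCompact_uIcc).mono_set
      (Ioc_subset_Icc_self.trans Icc_subset_uIcc)).ofReal,
     ((hφ.integrableOn_isCompact isCompact_uIcc).mono_set
      (Ioc_subset_Icc_self.trans Icc_subset_uIcc')).ofReal⟩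
  exact h.continuousOn_mul (by fun_prop)

/-- Translating a square integrable function multiplies its truncated Fourier integral by a phase,
up to an error that vanishes in the limit. -/
theorem tendsto_truncFourier_comp_add_sub {φ : ℝ → ℝ} (hφ : MemLp φ 2 volume) (ω x : ℝ) :
    Tendsto (fun T => truncFourier (fun t => φ (t + x)) ω T
      - Complex.exp (-(Complex.I * ω * x)) * truncFourier φ ω T) atTop (𝓝 0) := by
  have hloc : LocallyIntegrable φ := hφ.locallyIntegrable (by norm_num)
  set e : ℝ → ℂ := fun t => Complex.exp (Complex.I * ω * (t : ℂ)) * (φ t : ℂ) with he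
  have hi : ∀ a b, IntervalIntegrable e volume a b := intervalIntegrable_cexp_mul hloc _
  -- After substitution the two domains of integration differ only by the windows of length `|x|` at
  -- `T` and at `-T`.
  have heq : ∀ T, truncFourier (fun t => φ (t + x)) ω T
      - Complex.exp (-(Complex.I * ω * x)) * truncFourier φ ω T
      = Complex.exp (-(Complex.I * ω * x)) *
        ((∫ t in T..(T + x), e t) - ∫ t in (-T)..(-T + x), e t) := by
    intro T
    have h1 : truncFourier (fun t => φ (t + x)) ω T
        = Complex.exp (-(Complex.I * ω * x)) * ∫ t in (-T + x)..(T + x), e t := by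
      rw [truncFourier, ← intervalIntegral.integral_comp_add_right e x,
        ← intervalIntegral.integral_const_mul]
      refine intervalIntegral.integral_congr fun t _ => ?_
      simp only [he]
      rw [← mul_assoc, ← Complex.exp_add]
      congr 2
      push_cast; ring
    rw [h1, truncFourier, ← mul_sub]
    congr 1
    have h2 := intervalIntegral.integral_add_adjacent_intervals (hi (-T) (-T + x))
      (hi (-T + x) (T + x))
    have h3 := intervalIntegral.integral_add_adjacent_intervals (hi (-T) T) (hi T (T + x))
    rw [← sub_eq_zero] at h2 h3 ⊢
    linear_combination h2 - h3
  simp_rw [heq]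
  have hwin : ∀ T, ‖∫ t in T..(T + x), e t‖ ≤ ∫ t in Set.uIoc T (T + x), |φ t| := by
    intro T
    refine (intervalIntegral.norm_integral_le_integral_norm_uIoc).trans (le_of_eq ?_)
    refine integral_congr_ae (Eventually.of_forall fun t => ?_)
    simp only [he, norm_mul, norm_cexp_I_mul, one_mul, Complex.norm_real, Real.norm_eq_abs]
  have ht1 : Tendsto (fun T => ∫ t in T..(T + x), e t) atTop (𝓝 0) :=
    squeeze_zero_norm hwin (tendsto_integral_window_of_memLp_two hφ x atTop_le_cocompact)
  have ht2 : Tendsto (fun T => ∫ t in (-T)..(-T + x), e t) atTop (𝓝 0) :=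
    (squeeze_zero_norm hwin
      (tendsto_integral_window_of_memLp_two hφ x atBot_le_cocompact)).comp tendsto_neg_atTop_atBot
  simpa using (ht1.sub ht2).const_mul (Complex.exp (-(Complex.I * ω * x)))

theorem HasFourierValue.comp_add {φ : ℝ → ℝ} (hφ : MemLp φ 2 volume) {ω : ℝ} {z : ℂ}
    (h : HasFourierValue φ ω z) (x : ℝ) :
    HasFourierValue (fun t => φ (t + x)) ω (Complex.exp (-(Complex.I * ω * x)) * z) := by
  have := (tendsto_truncFourier_comp_add_sub hφ ω x).add
    (h.const_mul (Complex.exp (-(Complex.I * ω * x))))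
  simp only [sub_add_cancel, zero_add] at this
  exact this

theorem HasFourierValue.kernelFourier_eq {φ : ℝ → ℝ} {ω z : ℂ} (h : HasFourierValue φ ω z) :
    kernelFourier φ ω = z := h.limUnder_eq

theorem MemLp.comp_add_right_real {φ : ℝ → ℝ} {p : ENNReal} (hφ : MemLp φ p volume) (x : ℝ) :
    MemLp (fun t => φ (t + x)) p volume :=
  hφ.comp_measurePreserving (measurePreserving_add_right volume x)

theorem memLp_fwdDiff {φ : ℝ → ℝ} {p : ENNReal} (hφ : MemLp φ p volume) (x : ℝ) :
    MemLp (fwdDiff x φ) p volume :=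
  (MemLp.comp_add_right_real hφ x).sub hφ

theorem memLp_fwdDiff_iterate {φ : ℝ → ℝ} {p : ENNReal} (hφ : MemLp φ p volume) (x : ℝ) (n : ℕ) :
    MemLp ((fwdDiff x)^[n] φ) p volume := by
  induction n with
  | zero => simpa using hφ
  | succ n ih => rw [Function.iterate_succ_apply']; exact memLp_fwdDiff ih x

/-- If the truncated Fourier integrals of a finite difference converge, so do those of the
function itself. -/
theorem hasFourierValue_of_fwdDiff {φ : ℝ → ℝ} (hφ : MemLp φ 2 volume) {ω x : ℝ} {z : ℂ}
    (hx : Complex.exp (-(Complex.I * ω * x)) - 1 ≠ 0) (h : HasFourierValue (fwdDiff x φ) ω z) :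
    HasFourierValue φ ω (z / (Complex.exp (-(Complex.I * ω * x)) - 1)) := by
  have hloc : LocallyIntegrable φ := hφ.locallyIntegrable (by norm_num)
  have hloc' : LocallyIntegrable (fun t => φ (t + x)) :=
    (MemLp.comp_add_right_real hφ x).locallyIntegrable (by norm_num)
  have h1 := (Tendsto.sub h (tendsto_truncFourier_comp_add_sub hφ ω x)).div_const
    (Complex.exp (-(Complex.I * ω * x)) - 1)
  rw [sub_zero] at h1
  refine h1.congr fun T => ?_
  rw [div_eq_iff hx]
  have : truncFourier (fwdDiff x φ) ω T
      = truncFourier (fun t => φ (t + x)) ω T - truncFourier φ ω T := by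
    rw [truncFourier, truncFourier, truncFourier, ← intervalIntegral.integral_sub
      (intervalIntegrable_cexp_mul hloc' _ _ _) (intervalIntegrable_cexp_mul hloc _ _ _)]
    refine intervalIntegral.integral_congr fun t _ => ?_
    simp only [fwdDiff]; push_cast; ring
  rw [this]; ring

theorem hasFourierValue_of_fwdDiff_iterate {φ : ℝ → ℝ} (hφ : MemLp φ 2 volume) {ω x : ℝ} {z : ℂ}
    (hx : Complex.exp (-(Complex.I * ω * x)) - 1 ≠ 0) (n : ℕ)
    (h : HasFourierValue ((fwdDiff x)^[n] φ) ω z) :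
    HasFourierValue φ ω (z / (Complex.exp (-(Complex.I * ω * x)) - 1) ^ n) := by
  induction n generalizing z with
  | zero => simpa using h
  | succ n ih =>
    rw [Function.iterate_succ_apply'] at h
    have := ih (hasFourierValue_of_fwdDiff (memLp_fwdDiff_iterate hφ x n) hx h)
    rwa [div_div, ← pow_succ'] at this

/-- The truncated Fourier integrals of an integrable function converge to its Fourier integral. -/
theorem hasFourierValue_of_integrable {φ : ℝ → ℝ} (hφ : Integrable φ) (ω : ℝ) :
    HasFourierValue φ ω (∫ t : ℝ, Complex.exp (Complex.I * ω * (t : ℂ)) * (φ t : ℂ)) := by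
  refine intervalIntegral_tendsto_integral ?_ tendsto_neg_atTop_atBot tendsto_id
  refine (hφ.ofReal (𝕜 := ℂ)).bdd_mul (c := 1) (by fun_prop) ?_
  exact Eventually.of_forall fun t => (norm_cexp_I_mul ω t).le

/-! ### The `L²` Fourier transform and Parseval's identity -/

section Plancherel

open scoped FourierTransform SchwartzMap

/-- On integrable square integrable functions the `L²` Fourier transform is given by the Fourier
integral. -/
theorem coeFn_fourier_toLp_ae_eq {f : ℝ → ℂ} (h1 : Integrable f) (h2 : MemLp f 2 volume) :
    ((𝓕 (h2.toLp f) : Lp ℂ 2 (volume : Measure ℝ)) : ℝ → ℂ) =ᵐ[volume] 𝓕 f := by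
  -- Both sides are tested against smooth compactly supported functions: the `L²` transform is the
  -- distributional one, which moves onto the test function, and Fubini moves it back onto `f`.
  refine ae_eq_of_integral_contDiff_smul_eq
    ((Lp.memLp _).locallyIntegrable (by norm_num)) ?_ ?_
  · have : Continuous (𝓕 f) := VectorFourier.fourierIntegral_continuous
      Real.continuous_fourierChar (by exact continuous_inner) h1
    exact this.locallyIntegrable
  · intro φ hφ hφc
    have hc1 : HasCompactSupport (Complex.ofRealCLM ∘ φ) := hφc.comp_left rfl
    have hc2 : ContDiff ℝ (⊤ : ℕ∞) (Complex.ofRealCLM ∘ φ) := by fun_prop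
    set Φ : 𝓢(ℝ, ℂ) := hc1.toSchwartzMap hc2 with hΦ
    have hΦa : ∀ x, Φ x = (φ x : ℂ) := fun x => rfl
    have e1 : ∫ x, φ x • ((𝓕 (h2.toLp f) : Lp ℂ 2 (volume : Measure ℝ)) : ℝ → ℂ) x
        = (Lp.toTemperedDistribution (𝓕 (h2.toLp f) : Lp ℂ 2 (volume : Measure ℝ))) Φ := by
      rw [Lp.toTemperedDistribution_apply]
      simp_rw [hΦa]
      rfl
    rw [e1, ← Lp.fourier_toTemperedDistribution_eq, TemperedDistribution.fourier_apply,
      Lp.toTemperedDistribution_apply]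
    have e2 : ∫ x, (𝓕 Φ : 𝓢(ℝ, ℂ)) x • (h2.toLp f : ℝ → ℂ) x = ∫ x, 𝓕 (Φ : ℝ → ℂ) x • f x := by
      refine integral_congr_ae ?_
      filter_upwards [h2.coeFn_toLp] with x hx
      rw [hx, SchwartzMap.fourier_coe]
    rw [e2]
    have e3 := VectorFourier.integral_fourierIntegral_smul_eq_flip (L := innerₗ ℝ)
      Real.continuous_fourierChar continuous_inner Φ.integrable h1 (μ := volume) (ν := volume)
    rw [flip_innerₗ] at e3
    exact e3

/-- The kernel of `𝓕` is `e^{-2πiξt}`, which accounts for the frequency `ω = -2πξ`. -/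
theorem truncFourier_eq_fourier {φ : ℝ → ℝ} {T : ℝ} (hT : 0 ≤ T) (ξ : ℝ) :
    truncFourier φ ((-(2 * Real.pi * ξ) : ℝ) : ℂ) T
      = 𝓕 ((Ioc (-T) T).indicator (fun t => (φ t : ℂ))) ξ := by
  rw [Real.fourier_real_eq_integral_exp_smul, truncFourier,
    intervalIntegral.integral_of_le (by linarith), ← integral_indicator measurableSet_Ioc]
  refine integral_congr_ae (Eventually.of_forall fun t => ?_)
  simp only [indicator]
  split_ifs
  · rw [smul_eq_mul]; congr 2; push_cast; ring
  · simp

/-- Where the truncated Fourier integrals of a square integrable function converge, their limit is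
the `L²` Fourier transform. -/
theorem kernelFourier_ae_eq_fourier {φ : ℝ → ℝ}
    (hφc : MemLp (fun t => (φ t : ℂ)) 2 (volume : Measure ℝ))
    (h : ∀ ω : ℝ, ω ≠ 0 → HasFourierValue φ ω (kernelFourier φ ω)) :
    ((𝓕 (hφc.toLp _) : Lp ℂ 2 (volume : Measure ℝ)) : ℝ → ℂ)
      =ᵐ[volume] fun ξ => kernelFourier φ ((-(2 * Real.pi * ξ) : ℝ) : ℂ) := by
  set F : ℝ → ℂ := fun t => (φ t : ℂ) with hF
  set tr : ℕ → ℝ → ℂ := fun n => (Ioc (-(n : ℝ)) n).indicator F with htr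
  have htr2 : ∀ n, MemLp (tr n) 2 (volume : Measure ℝ) := fun n => hφc.indicator measurableSet_Ioc
  have htr1 : ∀ n, Integrable (tr n) := fun n => by
    rw [htr, integrable_indicator_iff measurableSet_Ioc]
    exact ((hφc.locallyIntegrable (by norm_num)).integrableOn_isCompact isCompact_Icc).mono_set
      Ioc_subset_Icc_self
  have hlim : Tendsto (fun n => (htr2 n).toLp (tr n)) atTop (𝓝 (hφc.toLp F)) := by
    rw [Lp.tendsto_Lp_iff_tendsto_eLpNorm'']
    have : ∀ n, eLpNorm (tr n - F) 2 volume = eLpNorm ((Ioc (-(n : ℝ)) n)ᶜ.indicator F) 2 volume := by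
      intro n
      refine eLpNorm_congr_norm_ae ?_
      refine Eventually.of_forall fun t => ?_
      by_cases ht : t ∈ Ioc (-(n : ℝ)) n <;> simp [htr, ht]
    simp_rw [this]
    have hint : ∫⁻ t, ‖F t‖ₑ ^ (2 : ℝ) ≠ ⊤ := by
      have := hφc.eLpNorm_lt_top
      rw [eLpNorm_lt_top_iff_lintegral_rpow_enorm_lt_top (by norm_num) (by norm_num)] at this
      simpa using this.ne
    have hL : Tendsto (fun n : ℕ => ∫⁻ t, ‖(Ioc (-(n : ℝ)) n)ᶜ.indicator F t‖ₑ ^ (2 : ℝ)) atTop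
        (𝓝 (∫⁻ _ : ℝ, 0)) := by
      refine tendsto_lintegral_of_dominated_convergence' (fun t => ‖F t‖ₑ ^ (2 : ℝ)) ?_ ?_ hint ?_
      · exact fun n => ((hφc.aestronglyMeasurable.indicator
          measurableSet_Ioc.compl).enorm).pow_const _
      · refine fun n => Eventually.of_forall fun t => ?_
        exact ENNReal.rpow_le_rpow (enorm_indicator_le_enorm_self _ _) (by norm_num)
      · refine Eventually.of_forall fun t => tendsto_const_nhds.congr' ?_
        filter_upwards [tendsto_natCast_atTop_atTop.eventually_gt_atTop |t|] with n hn
        rw [indicator_of_notMem]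
        · simp
        · rw [abs_lt] at hn
          simp [hn.1, hn.2.le]
    have hE : ∀ n : ℕ, eLpNorm ((Ioc (-(n : ℝ)) n)ᶜ.indicator F) 2 volume
        = (∫⁻ t, ‖(Ioc (-(n : ℝ)) n)ᶜ.indicator F t‖ₑ ^ (2 : ℝ)) ^ ((1 : ℝ) / 2) := fun n => by
      rw [eLpNorm_eq_lintegral_rpow_enorm_toReal (by norm_num) (by norm_num)]; simp
    simp_rw [hE]
    simpa using hL.ennrpow_const ((1 : ℝ) / 2)
  have hlimF : Tendsto (fun n => (𝓕 ((htr2 n).toLp (tr n)) : Lp ℂ 2 (volume : Measure ℝ))) atTop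
      (𝓝 (𝓕 (hφc.toLp F))) :=
    ((Lp.fourierTransformₗᵢ ℝ ℂ).continuous.tendsto _).comp hlim
  -- `L²` convergence yields almost everywhere convergence along a subsequence, enough to identify
  -- the limit because the pointwise limit exists by hypothesis.
  obtain ⟨ns, hns, hae⟩ := (tendstoInMeasure_of_tendsto_Lp hlimF).exists_seq_tendsto_ae
  have hall : ∀ᵐ ξ : ℝ, ∀ n, (𝓕 ((htr2 n).toLp (tr n)) : Lp ℂ 2 (volume : Measure ℝ)) ξ
      = 𝓕 (tr n) ξ :=
    ae_all_iff.2 fun n => coeFn_fourier_toLp_ae_eq (htr1 n) (htr2 n)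
  have hne : ∀ᵐ ξ : ℝ, ξ ≠ 0 := Measure.ae_ne volume 0
  filter_upwards [hae, hall, hne] with ξ h1 h2 h3
  have h4 := h (-(2 * Real.pi * ξ)) (neg_ne_zero.2 (by positivity))
  have h5 : Tendsto (fun i => truncFourier φ ((-(2 * Real.pi * ξ) : ℝ) : ℂ) (ns i)) atTop
      (𝓝 (kernelFourier φ ((-(2 * Real.pi * ξ) : ℝ) : ℂ))) :=
    h4.comp (tendsto_natCast_atTop_atTop.comp hns.tendsto_atTop)
  refine tendsto_nhds_unique h1 (h5.congr fun i => ?_)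
  rw [h2, truncFourier_eq_fourier (by positivity)]

/-- Parseval's identity for the autocovariance of a kernel. -/
theorem integral_mul_comp_add_eq {φ : ℝ → ℝ} (hφ : MemLp φ 2 volume)
    (h : ∀ ω : ℝ, ω ≠ 0 → HasFourierValue φ ω (kernelFourier φ ω)) :
    Integrable (fun ω : ℝ => ‖kernelFourier φ ω‖ ^ 2) ∧
    ∀ x : ℝ, ((∫ t, φ (t + x) * φ t : ℝ) : ℂ) = (1 / (2 * Real.pi) : ℝ) *
      ∫ ω : ℝ, Complex.exp (Complex.I * ω * x) * ((‖kernelFourier φ ω‖ ^ 2 : ℝ) : ℂ) := by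
  have hφc : MemLp (fun t => (φ t : ℂ)) 2 (volume : Measure ℝ) := hφ.ofReal
  have hae := kernelFourier_ae_eq_fourier hφc h
  have hpi : (-(2 * Real.pi)) ≠ 0 := neg_ne_zero.2 (by positivity)
  constructor
  · have h1 : MemLp (fun ξ : ℝ => kernelFourier φ ((-(2 * Real.pi * ξ) : ℝ) : ℂ)) 2 volume :=
      (memLp_congr_ae hae).1 (Lp.memLp _)
    have h2 := h1.integrable_norm_pow (by norm_num)
    rw [← integrable_comp_mul_left_iff _ hpi]
    refine h2.congr (Eventually.of_forall fun ξ => ?_)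
    simp
  · intro x
    set ψ : ℝ → ℝ := fun t => φ (t + x) with hψ
    have hψ2 : MemLp ψ 2 volume := MemLp.comp_add_right_real hφ x
    have hψc : MemLp (fun t => (ψ t : ℂ)) 2 (volume : Measure ℝ) := hψ2.ofReal
    have hψF : ∀ ω : ℝ, ω ≠ 0 → kernelFourier ψ ω
        = Complex.exp (-(Complex.I * ω * x)) * kernelFourier φ ω := fun ω hω =>
      ((h ω hω).comp_add hφ x).kernelFourier_eq
    have hψ' : ∀ ω : ℝ, ω ≠ 0 → HasFourierValue ψ ω (kernelFourier ψ ω) := fun ω hω => by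
      rw [hψF ω hω]; exact (h ω hω).comp_add hφ x
    have hae' := kernelFourier_ae_eq_fourier hψc hψ'
    have key := Lp.inner_fourier_eq (hψc.toLp _) (hφc.toLp _)
    rw [L2.inner_def, L2.inner_def] at key
    have e1 : ∫ t, inner ℂ ((hψc.toLp _ : Lp ℂ 2 (volume : Measure ℝ)) t)
        ((hφc.toLp _ : Lp ℂ 2 (volume : Measure ℝ)) t) = ((∫ t, φ (t + x) * φ t : ℝ) : ℂ) := by
      rw [← integral_complex_ofReal]
      refine integral_congr_ae ?_
      filter_upwards [hψc.coeFn_toLp, hφc.coeFn_toLp] with t h1 h2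
      rw [h1, h2, RCLike.inner_apply, Complex.conj_ofReal]
      simp [hψ, mul_comm]
    rw [e1] at key
    rw [← key]
    have e2 : ∫ ξ, inner ℂ ((𝓕 (hψc.toLp _) : Lp ℂ 2 (volume : Measure ℝ)) ξ)
        ((𝓕 (hφc.toLp _) : Lp ℂ 2 (volume : Measure ℝ)) ξ)
        = ∫ ξ : ℝ, (fun ω : ℝ => Complex.exp (Complex.I * ω * x) *
            ((‖kernelFourier φ ω‖ ^ 2 : ℝ) : ℂ)) (-(2 * Real.pi) * ξ) := by
      refine integral_congr_ae ?_
      have hne : ∀ᵐ ξ : ℝ, ξ ≠ 0 := Measure.ae_ne volume 0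
      filter_upwards [hae, hae', hne] with ξ h1 h2 h3
      have h3' : -(2 * Real.pi * ξ) ≠ 0 := neg_ne_zero.2 (by positivity)
      rw [h1, h2, hψF _ h3', RCLike.inner_apply, map_mul, ← Complex.exp_conj]
      have : -(2 * Real.pi) * ξ = -(2 * Real.pi * ξ) := by ring
      simp only [this]
      rw [mul_comm, mul_assoc, mul_comm ((starRingEnd ℂ) _) , Complex.mul_conj, Complex.normSq_eq_norm_sq]
      congr 2
      rw [map_neg, map_mul, map_mul, Complex.conj_I, Complex.conj_ofReal, Complex.conj_ofReal]
      ring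
    rw [e2, Measure.integral_comp_mul_left (fun ω : ℝ => Complex.exp (Complex.I * ω * x) *
            ((‖kernelFourier φ ω‖ ^ 2 : ℝ) : ℂ))]
    rw [abs_inv, abs_neg, abs_of_pos (by positivity)]
    simp

end Plancherel

/-! ### The `L²` integral: isometry, autocovariance and spectral density -/

section OrthogonalNoise

variable {Ω : Type*} [MeasurableSpace Ω]

/-- The step function `∑ cᵢ 1_{(aᵢ, bᵢ]}`. -/
noncomputable def stepFn {m : ℕ} (a b c : Fin m → ℝ) (s : ℝ) : ℝ :=
  ∑ i, c i * (Ioc (a i) (b i)).indicator (fun _ => (1 : ℝ)) s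

/-- The elementary integral `∑ cᵢ (L_{bᵢ} - L_{aᵢ})`. -/
def stepInt (L : ℝ → Ω → ℝ) {m : ℕ} (a b c : Fin m → ℝ) (x : Ω) : ℝ :=
  ∑ i, c i * (L (b i) x - L (a i) x)

theorem memLp_stepFn {m : ℕ} (a b c : Fin m → ℝ) : MemLp (stepFn a b c) 2 volume := by
  refine memLp_finsetSum _ fun i _ => MemLp.const_mul ?_ _
  exact memLp_indicator_const 2 measurableSet_Ioc 1 (Or.inr measure_Ioc_lt_top.ne)

namespace IsOrthogonalNoise

variable {P : Measure Ω} {L : ℝ → Ω → ℝ} {σ : ℝ}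

theorem memLp_stepInt (hL : IsOrthogonalNoise P L σ) {m : ℕ} (a b c : Fin m → ℝ) :
    MemLp (stepInt L a b c) 2 P :=
  memLp_finsetSum _ fun i _ => (hL.memLp (a i) (b i)).const_mul _

theorem integral_stepInt [IsProbabilityMeasure P] (hL : IsOrthogonalNoise P L σ) {m : ℕ}
    (a b c : Fin m → ℝ) : ∫ x, stepInt L a b c x ∂P = 0 := by
  unfold stepInt
  rw [integral_finsetSum _ fun i _ => ((hL.memLp (a i) (b i)).integrable (by norm_num)).const_mul _]
  simp [integral_const_mul, hL.mean_zero]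

theorem integral_sq (hL : IsOrthogonalNoise P L σ) (s t : ℝ) :
    ∫ x, (L t x - L s x) ^ 2 ∂P = σ ^ 2 * |t - s| := by
  rcases le_total s t with h | h
  · rw [hL.second_moment s t h, abs_of_nonneg (by linarith)]
  · rw [abs_sub_comm, abs_of_nonneg (by linarith), ← hL.second_moment t s h]
    congr 1 with x
    ring

/-- The covariance of two increments, by polarization. -/
theorem integral_mul (hL : IsOrthogonalNoise P L σ) (a b c d : ℝ) :
    ∫ x, (L b x - L a x) * (L d x - L c x) ∂P
      = σ ^ 2 * ((|b - c| + |a - d| - |b - d| - |a - c|) / 2) := by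
  have hi : ∀ s t, Integrable (fun x => (L t x - L s x) ^ 2) P := fun s t =>
    (hL.memLp s t).integrable_sq
  have : ∀ x, (L b x - L a x) * (L d x - L c x) = ((L b x - L c x) ^ 2 + (L a x - L d x) ^ 2
      - (L b x - L d x) ^ 2 - (L a x - L c x) ^ 2) / 2 := fun x => by ring
  simp_rw [this]
  have h1 : Integrable (fun x => (L b x - L c x) ^ 2 + (L a x - L d x) ^ 2) P :=
    (hi c b).add (hi d a)
  have h2 : Integrable (fun x => (L b x - L c x) ^ 2 + (L a x - L d x) ^ 2
      - (L b x - L d x) ^ 2) P := h1.sub (hi d b)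
  rw [integral_div, integral_sub h2 (hi c a), integral_sub h1 (hi d b),
    integral_add (hi c b) (hi d a),
    hL.integral_sq, hL.integral_sq, hL.integral_sq, hL.integral_sq]
  ring

end IsOrthogonalNoise

/-- The length of the overlap is written in the form that polarization gives for the covariance of
two increments, so that the isometry needs no case distinction on the intervals. -/
theorem integral_indicator_Ioc_mul {a b c d : ℝ} (hab : a ≤ b) (hcd : c ≤ d) :
    ∫ s, (Ioc a b).indicator (fun _ => (1 : ℝ)) s * (Ioc c d).indicator (fun _ => (1 : ℝ)) s
      = (|b - c| + |a - d| - |b - d| - |a - c|) / 2 := by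
  have : ∀ s, (Ioc a b).indicator (fun _ => (1 : ℝ)) s * (Ioc c d).indicator (fun _ => (1 : ℝ)) s
      = (Ioc (max a c) (min b d)).indicator (fun _ => (1 : ℝ)) s := fun s => by
    rw [← Ioc_inter_Ioc]
    by_cases h1 : s ∈ Ioc a b <;> by_cases h2 : s ∈ Ioc c d <;> simp only [indicator, h1, h2,
      mem_inter_iff, if_true, if_false, and_true, and_false, mul_one, mul_zero]
  simp_rw [this]
  rw [integral_indicator measurableSet_Ioc, setIntegral_const]
  simp only [Measure.real, Real.volume_Ioc, smul_eq_mul, mul_one, ENNReal.toReal_ofReal']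
  rcases le_total a c with h1 | h1 <;> rcases le_total b d with h2 | h2 <;>
  rcases le_total b c with h3 | h3 <;> rcases le_total a d with h4 | h4 <;>
  simp only [h1, h2, max_eq_left, max_eq_right, min_eq_left, min_eq_right,
    abs_of_nonneg, abs_of_nonpos, sub_nonneg, sub_nonpos, h3, h4] <;>
  first
  | linarith
  | (rw [max_eq_left (by linarith)]; linarith)

theorem IsOrthogonalNoise.integral_stepInt_mul {P : Measure Ω} {L : ℝ → Ω → ℝ} {σ : ℝ}
    (hL : IsOrthogonalNoise P L σ) {m n : ℕ} {a b : Fin m → ℝ} {a' b' : Fin n → ℝ}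
    (hab : ∀ i, a i ≤ b i) (hab' : ∀ i, a' i ≤ b' i) (c : Fin m → ℝ) (c' : Fin n → ℝ) :
    ∫ x, stepInt L a b c x * stepInt L a' b' c' x ∂P
      = σ ^ 2 * ∫ s, stepFn a b c s * stepFn a' b' c' s := by
  have hI : ∀ i : Fin m, ∀ j : Fin n, Integrable (fun x => c i * (L (b i) x - L (a i) x)
      * (c' j * (L (b' j) x - L (a' j) x))) P := fun i j =>
    ((hL.memLp (a i) (b i)).const_mul (c i)).integrable_mul
      ((hL.memLp (a' j) (b' j)).const_mul (c' j))
  have hm : ∀ a b : ℝ, MemLp ((Ioc a b).indicator (fun _ => (1 : ℝ))) 2 volume := fun a b =>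
    memLp_indicator_const 2 measurableSet_Ioc 1 (Or.inr measure_Ioc_lt_top.ne)
  have hI' : ∀ i : Fin m, ∀ j : Fin n, Integrable (fun s : ℝ =>
      c i * (Ioc (a i) (b i)).indicator (fun _ => (1 : ℝ)) s
      * (c' j * (Ioc (a' j) (b' j)).indicator (fun _ => (1 : ℝ)) s)) := fun i j =>
    ((hm (a i) (b i)).const_mul (c i)).integrable_mul ((hm (a' j) (b' j)).const_mul (c' j))
  simp only [stepInt, stepFn, Finset.sum_mul_sum]
  rw [integral_finsetSum _ fun i _ => integrable_finsetSum _ fun j _ => hI i j,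
    integral_finsetSum _ fun i _ => integrable_finsetSum _ fun j _ => hI' i j, Finset.mul_sum]
  refine Finset.sum_congr rfl fun i _ => ?_
  rw [integral_finsetSum _ fun j _ => hI i j, integral_finsetSum _ fun j _ => hI' i j,
    Finset.mul_sum]
  refine Finset.sum_congr rfl fun j _ => ?_
  have e1 : ∀ x, c i * (L (b i) x - L (a i) x) * (c' j * (L (b' j) x - L (a' j) x))
      = c i * c' j * ((L (b i) x - L (a i) x) * (L (b' j) x - L (a' j) x)) := fun x => by ring
  have e2 : ∀ s, c i * (Ioc (a i) (b i)).indicator (fun _ => (1 : ℝ)) s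
      * (c' j * (Ioc (a' j) (b' j)).indicator (fun _ => (1 : ℝ)) s)
      = c i * c' j * ((Ioc (a i) (b i)).indicator (fun _ => (1 : ℝ)) s
        * (Ioc (a' j) (b' j)).indicator (fun _ => (1 : ℝ)) s) := fun s => by ring
  simp_rw [e1, e2]
  rw [integral_const_mul, integral_const_mul, hL.integral_mul,
    integral_indicator_Ioc_mul (hab i) (hab' j)]
  ring

/-- An `L²` integral is an `L²` limit of elementary integrals of approximating step functions. -/
theorem IsL2Integral.exists_seq {P : Measure Ω} {L : ℝ → Ω → ℝ} {σ : ℝ}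
    (hL : IsOrthogonalNoise P L σ) {f : ℝ → ℝ} (hf : MemLp f 2 volume) {Z : Ω → ℝ}
    (hZ : IsL2Integral P L f Z) :
    ∃ (m : ℕ → ℕ) (a b c : ∀ n, Fin (m n) → ℝ), (∀ n i, a n i ≤ b n i) ∧
      Tendsto (fun n => (memLp_stepFn (a n) (b n) (c n)).toLp) atTop (𝓝 (hf.toLp f)) ∧
      Tendsto (fun n => (hL.memLp_stepInt (a n) (b n) (c n)).toLp) atTop (𝓝 (hZ.1.toLp Z)) := by
  choose m a b c hab h1 h2 using fun n : ℕ => hZ.2 (1 / ((n : ℝ) + 1)) (by positivity)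
  have h0 : Tendsto (fun n : ℕ => ENNReal.ofReal (1 / ((n : ℝ) + 1))) atTop (𝓝 0) := by
    simpa using ENNReal.tendsto_ofReal tendsto_one_div_add_atTop_nhds_zero_nat
  refine ⟨m, a, b, c, hab, ?_, ?_⟩
  · rw [Lp.tendsto_Lp_iff_tendsto_eLpNorm'']
    refine tendsto_of_tendsto_of_tendsto_of_le_of_le tendsto_const_nhds h0 (fun _ => zero_le)
      fun n => ?_
    rw [eLpNorm_sub_comm]
    exact h1 n
  · rw [Lp.tendsto_Lp_iff_tendsto_eLpNorm'']
    refine tendsto_of_tendsto_of_tendsto_of_le_of_le tendsto_const_nhds h0 (fun _ => zero_le)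
      fun n => ?_
    rw [eLpNorm_sub_comm]
    exact h2 n

theorem inner_toLp_two {α : Type*} [MeasurableSpace α] {μ : Measure α} {f g : α → ℝ}
    (hf : MemLp f 2 μ) (hg : MemLp g 2 μ) :
    inner ℝ (hf.toLp f) (hg.toLp g) = ∫ x, f x * g x ∂μ := by
  rw [L2.inner_def]
  refine integral_congr_ae ?_
  filter_upwards [hf.coeFn_toLp, hg.coeFn_toLp] with x h1 h2
  rw [h1, h2]
  simp [mul_comm]

/-- The isometry property of the `L²` integral. -/
theorem IsL2Integral.integral_mul {P : Measure Ω} {L : ℝ → Ω → ℝ} {σ : ℝ}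
    (hL : IsOrthogonalNoise P L σ) {f f' : ℝ → ℝ} (hf : MemLp f 2 volume)
    (hf' : MemLp f' 2 volume) {Z Z' : Ω → ℝ}
    (hZ : IsL2Integral P L f Z) (hZ' : IsL2Integral P L f' Z') :
    ∫ x, Z x * Z' x ∂P = σ ^ 2 * ∫ s, f s * f' s := by
  obtain ⟨m, a, b, c, hab, h1, h2⟩ := hZ.exists_seq hL hf
  obtain ⟨m', a', b', c', hab', h1', h2'⟩ := hZ'.exists_seq hL hf'
  rw [← inner_toLp_two hZ.1 hZ'.1, ← inner_toLp_two hf hf']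
  refine tendsto_nhds_unique (h2.inner h2') ?_
  refine ((h1.inner h1').const_mul (σ ^ 2)).congr fun n => ?_
  rw [inner_toLp_two, inner_toLp_two, hL.integral_stepInt_mul (hab n) (hab' n)]

theorem IsL2Integral.integral_eq_zero {P : Measure Ω} [IsProbabilityMeasure P]
    {L : ℝ → Ω → ℝ} {σ : ℝ} (hL : IsOrthogonalNoise P L σ) {f : ℝ → ℝ} (hf : MemLp f 2 volume)
    {Z : Ω → ℝ} (hZ : IsL2Integral P L f Z) : ∫ x, Z x ∂P = 0 := by
  obtain ⟨m, a, b, c, -, -, h2⟩ := hZ.exists_seq hL hf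
  have h1 : MemLp (fun _ : Ω => (1 : ℝ)) 2 P := memLp_const 1
  -- The mean is the inner product with the constant `1`, which is continuous in `L²` and zero on
  -- elementary integrals.
  have h3 := h2.inner (𝕜 := ℝ) (tendsto_const_nhds (x := h1.toLp _))
  simp_rw [inner_toLp_two, mul_one, hL.integral_stepInt] at h3
  exact (tendsto_nhds_unique h3 tendsto_const_nhds)

/-- The autocovariance function of a continuous-time moving average. -/
theorem IsCMAProcess.covariance_eq {P : Measure Ω} [IsProbabilityMeasure P]
    {L Y : ℝ → Ω → ℝ} {σ : ℝ} (hL : IsOrthogonalNoise P L σ) {g : ℝ → ℝ} (hg : MemLp g 2 volume)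
    (hY : IsCMAProcess P L g Y) (t h : ℝ) :
    covariance (Y (t + h)) (Y t) P = σ ^ 2 * ∫ u, g (u + h) * g u := by
  have hm : ∀ t : ℝ, MemLp (fun s => g (t - s)) 2 volume := fun t =>
    hg.comp_measurePreserving (Measure.measurePreserving_sub_left volume t)
  rw [covariance, (hY (t + h)).integral_eq_zero hL (hm _), (hY t).integral_eq_zero hL (hm _)]
  simp only [sub_zero]
  rw [(hY (t + h)).integral_mul hL (hm _) (hm _) (hY t),
    ← integral_sub_left_eq_self (fun u => g (u + h) * g u) volume t]
  congr 2 with s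
  congr 2; ring

/-- If the Fourier integrals of the kernel converge away from zero, then the moving average has a
spectral density given by the squared modulus of the Fourier transform. -/
theorem IsCMAProcess.isSpectralDensity {P : Measure Ω} [IsProbabilityMeasure P]
    {L Y : ℝ → Ω → ℝ} {σ : ℝ} (hL : IsOrthogonalNoise P L σ) {g : ℝ → ℝ} (hg : MemLp g 2 volume)
    (hY : IsCMAProcess P L g Y)
    (hF : ∀ ω : ℝ, ω ≠ 0 → HasFourierValue g ω (kernelFourier g ω)) :
    IsSpectralDensity P Y (cmaSpectralDensity σ g) := by
  obtain ⟨h1, h2⟩ := integral_mul_comp_add_eq hg hF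
  refine ⟨fun ω => by unfold cmaSpectralDensity; positivity, h1.const_mul _, fun t h => ?_⟩
  rw [hY.covariance_eq hL hg, Complex.ofReal_mul, h2, ← mul_assoc, ← integral_const_mul]
  refine integral_congr_ae (Eventually.of_forall fun ω => ?_)
  simp only [cmaSpectralDensity]
  push_cast
  ring

end OrthogonalNoise

/-! ### Uniform convergence, Potter's bounds and regular variation at zero -/

/-- The uniform convergence theorem for slowly varying functions, in additive form. -/
theorem eventually_forall_abs_sub_lt_of_slowlyVarying {F : ℝ → ℝ} (hF : AEMeasurable F volume)
    (h : ∀ u, Tendsto (fun x => F (x + u) - F x) atTop (𝓝 0)) {ε : ℝ} (hε : 0 < ε) :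
    ∀ᶠ x in atTop, ∀ u ∈ Icc (0 : ℝ) 1, |F (x + u) - F x| < 2 * ε := by
  by_contra hcon
  have hfreq : ∀ n : ℕ, ∃ x : ℝ, (n : ℝ) ≤ x ∧ ∃ u ∈ Icc (0 : ℝ) 1, 2 * ε ≤ |F (x + u) - F x| := by
    intro n
    by_contra hn
    push Not at hn
    exact hcon ((eventually_ge_atTop (n : ℝ)).mono hn)
  choose x hx u hu hxu using hfreq
  have hxt : Tendsto x atTop atTop := tendsto_atTop_mono hx tendsto_natCast_atTop_atTop
  have hxut : Tendsto (fun n => x n + u n) atTop atTop :=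
    tendsto_atTop_mono (fun n => le_add_of_nonneg_right (hu n).1) hxt
  -- These sets increase to `[0, 2]`, so for large `N` the one for `x` and the one for `x + u` each
  -- have measure above `3 / 2`. The second, shifted by `u N`, and the first both lie in `[0, 3]`,
  -- hence would have to meet; at a common point the triangle inequality gives `|F (x + u) - F x| <
  -- 2 ε`, contrary to the choice of `x` and `u`.
  set W : (ℕ → ℝ) → ℕ → Set ℝ := fun z n =>
    Icc 0 2 ∩ ⋂ m : ℕ, ⋂ _ : n ≤ m, {y | |F (z m + y) - F (z m)| < ε} with hW
  have hWmono : ∀ z, Monotone (W z) := by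
    intro z n k hnk y hy
    simp only [hW, mem_inter_iff, mem_iInter, mem_ofPred_eq] at hy ⊢
    exact ⟨hy.1, fun m hm => hy.2 m (hnk.trans hm)⟩
  have hWU : ∀ z, Tendsto z atTop atTop → ⋃ n, W z n = Icc 0 2 := by
    intro z hz
    refine subset_antisymm (iUnion_subset fun n => inter_subset_left) fun y hy => ?_
    have h1 := (Metric.tendsto_atTop.1 ((h y).comp hz)) ε hε
    obtain ⟨N, hN⟩ := h1
    simp only [hW, mem_iUnion, mem_inter_iff, mem_iInter, mem_ofPred_eq]
    refine ⟨N, hy, fun m hm => ?_⟩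
    simpa [Real.dist_eq] using hN m hm
  have hWlarge : ∀ z, Tendsto z atTop atTop →
      ∀ᶠ n in atTop, ENNReal.ofReal (3 / 2) < volume (W z n) := by
    intro z hz
    have h1 := tendsto_measure_iUnion_atTop (μ := (volume : Measure ℝ)) (hWmono z)
    rw [hWU z hz, Real.volume_Icc] at h1
    exact h1.eventually_const_lt
      ((ENNReal.ofReal_lt_ofReal_iff (by norm_num)).2 (by norm_num))
  obtain ⟨N, hN1, hN2⟩ := ((hWlarge x hxt).and (hWlarge _ hxut)).exists
  have hnull : NullMeasurableSet (W x N) volume := by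
    refine measurableSet_Icc.nullMeasurableSet.inter (NullMeasurableSet.iInter fun m =>
      NullMeasurableSet.iInter fun _ => ?_)
    have h2 : AEMeasurable (fun y => |F (x m + y) - F (x m)|) volume := by
      have h3 := hF.comp_quasiMeasurePreserving
        (measurePreserving_add_left volume (x m)).quasiMeasurePreserving
      exact measurable_norm.comp_aemeasurable (h3.sub_const _)
    exact nullMeasurableSet_lt h2 aemeasurable_const
  set B : Set ℝ := (fun y => y + -u N) ⁻¹' W (fun n => x n + u n) N with hB
  have hBvol : volume B = volume (W (fun n => x n + u n) N) := measure_preimage_add_right _ _ _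
  have hdisj : Disjoint B (W x N) := by
    rw [Set.disjoint_left]
    intro y hyB hyA
    simp only [hB, hW, mem_preimage, mem_inter_iff, mem_iInter, mem_ofPred_eq] at hyA hyB
    have h1 := hyA.2 N le_rfl
    have h2 := hyB.2 N le_rfl
    rw [show x N + u N + (y + -u N) = x N + y by ring] at h2
    have h3 := hxu N
    rw [abs_lt] at h1 h2
    rcases le_abs.1 h3 with h4 | h4 <;> linarith [h1.1, h1.2, h2.1, h2.2]
  have hsub : B ∪ W x N ⊆ Icc 0 3 := by
    rintro y (hy | hy)
    · have h1 := hy.1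
      simp only [mem_Icc] at h1
      have := hu N
      exact ⟨by linarith [this.1], by linarith [this.2]⟩
    · exact ⟨hy.1.1, hy.1.2.trans (by norm_num)⟩
  have h5 := measure_union₀ hnull hdisj.aedisjoint (μ := volume)
  have h6 := measure_mono hsub (μ := volume)
  rw [h5, hBvol, Real.volume_Icc] at h6
  have h7 := (ENNReal.add_lt_add hN2 hN1).trans_le h6
  rw [← ENNReal.ofReal_add (by norm_num) (by norm_num),
    ENNReal.ofReal_lt_ofReal_iff (by norm_num)] at h7
  norm_num at h7

/-- Potter's bounds in additive form. -/
theorem exists_forall_abs_sub_le_of_regularlyVarying {F : ℝ → ℝ} (hF : AEMeasurable F volume)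
    {c : ℝ} (h : ∀ u, Tendsto (fun x => F (x + u) - F x) atTop (𝓝 (c * u))) {ε : ℝ} (hε : 0 < ε) :
    ∃ X, ∀ x y, X ≤ x → x ≤ y → |F y - F x - c * (y - x)| ≤ ε * (y - x + 1) := by
  set G : ℝ → ℝ := fun x => F x - c * x with hG
  have hGm : AEMeasurable G volume := hF.sub (by fun_prop)
  have hGt : ∀ u, Tendsto (fun x => G (x + u) - G x) atTop (𝓝 0) := fun u => by
    have := (h u).sub_const (c * u)
    rw [sub_self] at this
    refine this.congr fun x => ?_
    simp only [hG]; ring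
  obtain ⟨X, hX⟩ := eventually_atTop.1
    (eventually_forall_abs_sub_lt_of_slowlyVarying hGm hGt (half_pos hε))
  have hstep : ∀ x, X ≤ x → ∀ u ∈ Icc (0 : ℝ) 1, |G (x + u) - G x| ≤ ε := fun x hx u hu => by
    have := hX x hx u hu
    linarith
  have hn : ∀ n : ℕ, ∀ x, X ≤ x → |G (x + n) - G x| ≤ ε * n := by
    intro n
    induction n with
    | zero => intro x _; simp
    | succ n ih =>
      intro x hx
      have h1 := ih x hx
      have h2 := hstep (x + n) (by linarith [n.cast_nonneg (α := ℝ)]) 1 ⟨zero_le_one, le_rfl⟩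
      have h3 : G (x + (n + 1 : ℕ)) - G x = (G (x + n + 1) - G (x + n)) + (G (x + n) - G x) := by
        push_cast; rw [add_assoc]; ring
      rw [h3]
      refine (abs_add_le _ _).trans ?_
      push_cast
      linarith
  refine ⟨X, fun x y hx hxy => ?_⟩
  -- The interval is covered by `n` unit steps and one fractional step, each costing at most `ε`.
  set n := ⌊y - x⌋₊ with hn'
  have hn1 : (n : ℝ) ≤ y - x := Nat.floor_le (by linarith)
  have hn2 : y - x < n + 1 := Nat.lt_floor_add_one _
  have h1 := hn n x hx
  have h2 := hstep (x + n) (by linarith [n.cast_nonneg (α := ℝ)]) (y - x - n)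
    ⟨by linarith, by linarith⟩
  rw [show x + n + (y - x - n) = y by ring] at h2
  have h3 : F y - F x - c * (y - x) = (G y - G (x + n)) + (G (x + n) - G x) := by
    simp only [hG]; ring
  rw [h3]
  refine (abs_add_le _ _).trans ?_
  nlinarith

/-- Preimages under `exp` are images under `log`, which is differentiable on `(0, ∞)` and so maps
null sets to null sets. This carries almost everywhere measurability of `f` over to `log ∘ f ∘ exp`.
-/
theorem quasiMeasurePreserving_exp :
    Measure.QuasiMeasurePreserving Real.exp volume (volume.restrict (Ioi 0)) := by
  refine ⟨Real.measurable_exp, Measure.AbsolutelyContinuous.mk fun s hs h0 => ?_⟩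
  rw [Measure.map_apply Real.measurable_exp hs]
  rw [Measure.restrict_apply hs] at h0
  have h1 : Real.exp ⁻¹' s = Real.log '' (s ∩ Ioi 0) := by
    ext y
    constructor
    · exact fun hy => ⟨Real.exp y, ⟨hy, Real.exp_pos y⟩, Real.log_exp y⟩
    · rintro ⟨z, ⟨hz, hz0⟩, rfl⟩
      rw [mem_preimage, Real.exp_log hz0]
      exact hz
  rw [h1]
  refine addHaar_image_eq_zero_of_differentiableOn_of_addHaar_eq_zero volume ?_ h0
  exact fun z hz => (Real.differentiableAt_log (ne_of_gt hz.2)).differentiableWithinAt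

/-- Potter's bounds for functions that are regularly varying at infinity. -/
theorem RegVarAtTop.potter {f : ℝ → ℝ} {ρ : ℝ} (hf : RegVarAtTop f ρ) {ε : ℝ} (hε : 0 < ε) :
    ∃ X C : ℝ, 0 < X ∧ 0 < C ∧ ∀ x y, X ≤ x → X ≤ y →
      0 < f x ∧ f y ≤ C * ((y / x) ^ (ρ - ε) + (y / x) ^ (ρ + ε)) * f x := by
  obtain ⟨X₀, hX₀⟩ := eventually_atTop.1 hf.eventually_pos
  set F : ℝ → ℝ := fun y => Real.log (f (Real.exp y)) with hF
  have hFm : AEMeasurable F volume :=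
    Real.measurable_log.comp_aemeasurable
      (hf.aemeasurable.comp_quasiMeasurePreserving quasiMeasurePreserving_exp)
  have hFt : ∀ u, Tendsto (fun x => F (x + u) - F x) atTop (𝓝 (ρ * u)) := by
    intro u
    have h1 := (hf.tendsto_ratio (Real.exp u) (Real.exp_pos u)).comp Real.tendsto_exp_atTop
    have h2 := h1.log (Real.rpow_pos_of_pos (Real.exp_pos u) ρ).ne'
    rw [Real.log_rpow (Real.exp_pos u), Real.log_exp] at h2
    refine h2.congr' ?_
    have hev := Real.tendsto_exp_atTop.eventually_ge_atTop X₀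
    have hev' := (tendsto_atTop_add_const_right atTop u tendsto_id).eventually
      (Real.tendsto_exp_atTop.eventually_ge_atTop X₀)
    filter_upwards [hev, hev'] with x hx hx'
    simp only [id] at hx'
    simp only [hF, Function.comp]
    rw [← Real.exp_add, add_comm u x, Real.log_div (hX₀ _ hx').ne' (hX₀ _ hx).ne']
  obtain ⟨X₁, hX₁⟩ := exists_forall_abs_sub_le_of_regularlyVarying hFm hFt hε
  refine ⟨max X₀ (Real.exp X₁), Real.exp ε, lt_max_of_lt_right (Real.exp_pos _), Real.exp_pos _,
    fun x y hx hy => ?_⟩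
  have hx0 : 0 < x := (Real.exp_pos _).trans_le ((le_max_right _ _).trans hx)
  have hy0 : 0 < y := (Real.exp_pos _).trans_le ((le_max_right _ _).trans hy)
  have hfx := hX₀ x ((le_max_left _ _).trans hx)
  have hfy := hX₀ y ((le_max_left _ _).trans hy)
  have hlx : X₁ ≤ Real.log x := (Real.le_log_iff_exp_le hx0).2 ((le_max_right _ _).trans hx)
  have hly : X₁ ≤ Real.log y := (Real.le_log_iff_exp_le hy0).2 ((le_max_right _ _).trans hy)
  refine ⟨hfx, ?_⟩
  have hr : 0 < y / x := div_pos hy0 hx0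
  have hlr : Real.log (y / x) = Real.log y - Real.log x := Real.log_div hy0.ne' hx0.ne'
  have key : ∀ s : ℝ, Real.log (f y) ≤ ε + s * Real.log (y / x) + Real.log (f x) →
      f y ≤ Real.exp ε * (y / x) ^ s * f x := by
    intro s hs
    rw [← Real.exp_log hfy, Real.rpow_def_of_pos hr]
    rw [← Real.exp_log hfx]
    rw [← Real.exp_add, ← Real.exp_add]
    exact Real.exp_le_exp.2 (by linarith)
  have hp1 : 0 ≤ (y / x) ^ (ρ - ε) := by positivity
  have hp2 : 0 ≤ (y / x) ^ (ρ + ε) := by positivity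
  have he := Real.exp_pos ε
  -- The error `ε |log (y / x)|` is absorbed into the exponent `ρ + ε` when `y ≥ x` and into `ρ - ε`
  -- when `y ≤ x`; the sum of both powers covers the two cases.
  rcases le_total x y with hxy | hxy
  · have h1 := hX₁ _ _ hlx (Real.log_le_log hx0 hxy)
    simp only [hF, Real.exp_log hx0, Real.exp_log hy0] at h1
    have h2 := key (ρ + ε) (by rw [hlr]; linarith [(abs_le.1 h1).2])
    refine h2.trans ?_
    gcongr
    linarith
  · have h1 := hX₁ _ _ hly (Real.log_le_log hy0 hxy)
    simp only [hF, Real.exp_log hx0, Real.exp_log hy0] at h1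
    have h2 := key (ρ - ε) (by rw [hlr]; linarith [(abs_le.1 h1).1])
    refine h2.trans ?_
    gcongr
    linarith

namespace RegVarAtZero

variable {f : ℝ → ℝ} {ρ : ℝ}

theorem eventually_pos (hf : RegVarAtZero f ρ) : ∀ᶠ x in 𝓝[>] (0 : ℝ), 0 < f x := by
  have := tendsto_inv_nhdsGT_zero.eventually (RegVarAtTop.eventually_pos hf)
  simpa using this

theorem tendsto_ratio (hf : RegVarAtZero f ρ) {l : ℝ} (hl : 0 < l) :
    Tendsto (fun x => f (l * x) / f x) (𝓝[>] 0) (𝓝 (l ^ ρ)) := by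
  have := (RegVarAtTop.tendsto_ratio hf l⁻¹ (inv_pos.2 hl)).comp tendsto_inv_nhdsGT_zero
  rw [Real.inv_rpow hl.le, Real.rpow_neg hl.le, inv_inv] at this
  refine this.congr fun x => ?_
  simp [Function.comp, mul_comm]

/-- Potter's bounds for functions that are regularly varying at zero. -/
theorem potter (hf : RegVarAtZero f ρ) {ε : ℝ} (hε : 0 < ε) :
    ∃ δ C : ℝ, 0 < δ ∧ 0 < C ∧ ∀ x y, 0 < x → x ≤ δ → 0 < y → y ≤ δ →
      0 < f x ∧ f y ≤ C * ((y / x) ^ (ρ - ε) + (y / x) ^ (ρ + ε)) * f x := by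
  obtain ⟨X, C, hX, hC, h⟩ := RegVarAtTop.potter hf hε
  refine ⟨X⁻¹, C, inv_pos.2 hX, hC, fun x y hx hx' hy hy' => ?_⟩
  have h1 := h (x⁻¹) (y⁻¹) ((le_inv_comm₀ hx hX).1 hx') ((le_inv_comm₀ hy hX).1 hy')
  simp only [one_div, inv_inv] at h1
  have e : y⁻¹ / x⁻¹ = (y / x)⁻¹ := by rw [inv_div, inv_div_inv]
  have hr : 0 < y / x := div_pos hy hx
  rw [e, Real.inv_rpow hr.le, Real.inv_rpow hr.le, ← Real.rpow_neg hr.le, ← Real.rpow_neg hr.le,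
    show -(-ρ - ε) = ρ + ε by ring, show -(-ρ + ε) = ρ - ε by ring, add_comm] at h1
  exact h1

end RegVarAtZero

/-! ### The Fourier constant of a truncated power -/

/-- The Laplace transform of a power on the half plane of convergence. -/
theorem integral_cexp_mul_rpow_Ioi {a : ℝ} (ha : 0 < a) {z : ℂ} (hz : z.re < 0) :
    ∫ u in Ioi (0 : ℝ), Complex.exp (z * u) * ((u ^ (a - 1) : ℝ) : ℂ)
      = (1 / -z) ^ (a : ℂ) * Complex.Gamma a := by
  set d : ℝ → NNReal := fun u => Real.toNNReal (u ^ (a - 1)) with hd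
  have hdm : Measurable d := by fun_prop
  -- The integral is the complex moment generating function of this measure, hence analytic on `Re z
  -- < 0`; the identity theorem extends the Gamma integral from the negative real axis.
  set μ : Measure ℝ := (volume.restrict (Ioi 0)).withDensity (fun u => (d u : ENNReal)) with hμ
  have hval : ∀ w : ℂ, complexMGF id μ w
      = ∫ u in Ioi (0 : ℝ), Complex.exp (w * u) * ((u ^ (a - 1) : ℝ) : ℂ) := by
    intro w
    rw [complexMGF, hμ, integral_withDensity_eq_integral_smul hdm]
    refine setIntegral_congr_fun measurableSet_Ioi fun u hu => ?_
    simp only [hd, id]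
    rw [NNReal.smul_def, Real.coe_toNNReal _ (Real.rpow_nonneg (le_of_lt hu) _), Complex.real_smul,
      mul_comm]
  have hexp : Iio (0 : ℝ) ⊆ integrableExpSet id μ := by
    intro s hs
    rw [mem_Iio] at hs
    simp only [integrableExpSet, mem_ofPred_eq]
    rw [hμ, integrable_withDensity_iff_integrable_smul hdm]
    have h1 := integrableOn_rpow_mul_exp_neg_mul_rpow (p := 1) (s := a - 1) (b := -s)
      (by linarith) one_pos (by linarith)
    refine (integrableOn_congr_fun (fun u hu => ?_) measurableSet_Ioi).1 h1
    simp only [hd, id]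
    rw [NNReal.smul_def, Real.coe_toNNReal _ (Real.rpow_nonneg (le_of_lt hu) _)]
    simp
  set S : Set ℂ := {w | w.re < 0} with hS
  have hSo : IsOpen S := isOpen_lt Complex.continuous_re continuous_const
  have hSc : IsPreconnected S := (convex_halfSpace_re_lt 0).isPreconnected
  have hA : AnalyticOnNhd ℂ (complexMGF id μ) S := by
    intro w hw
    exact analyticAt_complexMGF (interior_mono hexp (by rw [interior_Iio]; exact hw))
  have hB : AnalyticOnNhd ℂ (fun w : ℂ => (1 / -w) ^ (a : ℂ) * Complex.Gamma a) S := by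
    refine DifferentiableOn.analyticOnNhd (fun w hw => ?_) hSo
    have hw0 : w ≠ 0 := by rintro rfl; simp [hS] at hw
    have hsl : (1 / -w) ∈ Complex.slitPlane := by
      left
      rw [one_div, Complex.inv_re]
      have : 0 < (-w).re := by simpa [hS] using hw
      exact div_pos this (Complex.normSq_pos.2 (neg_ne_zero.2 hw0))
    refine DifferentiableAt.differentiableWithinAt ?_
    have h1 : DifferentiableAt ℂ (fun w : ℂ => 1 / -w) w :=
      (differentiableAt_const _).div differentiableAt_id.neg (neg_ne_zero.2 hw0)
    exact (h1.cpow (differentiableAt_const _) hsl).mul_const _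
  have hreal : ∀ s : ℝ, s < 0 → complexMGF id μ (s : ℂ)
      = (1 / -(s : ℂ)) ^ (a : ℂ) * Complex.Gamma a := by
    intro s hs
    rw [hval]
    have h1 := Complex.integral_cpow_mul_exp_neg_mul_Ioi (a := (a : ℂ)) (r := -s)
      (by simpa using ha) (by linarith)
    rw [Complex.ofReal_neg] at h1
    rw [← h1]
    refine setIntegral_congr_fun measurableSet_Ioi fun u hu => ?_
    rw [mul_comm, Complex.ofReal_cpow (le_of_lt hu)]
    push_cast
    simp
  have hfreq : ∃ᶠ w in 𝓝[≠] (-1 : ℂ), complexMGF id μ w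
      = (1 / -w) ^ (a : ℂ) * Complex.Gamma a := by
    have ht : Tendsto (fun s : ℝ => (s : ℂ)) (𝓝[≠] (-1 : ℝ)) (𝓝[≠] (-1 : ℂ)) := by
      refine tendsto_nhdsWithin_iff.2 ⟨?_, ?_⟩
      · have := (Complex.continuous_ofReal.tendsto (-1 : ℝ)).mono_left
          (nhdsWithin_le_nhds (s := {-1}ᶜ))
        simpa using this
      · filter_upwards [self_mem_nhdsWithin] with s hs
        intro h
        rw [mem_singleton_iff] at h
        exact hs (by rw [mem_singleton_iff]; exact_mod_cast h)
    refine ht.frequently (Eventually.frequently ?_)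
    have : ∀ᶠ s : ℝ in 𝓝[≠] (-1 : ℝ), s < 0 :=
      nhdsWithin_le_nhds (Iio_mem_nhds (by norm_num))
    exact this.mono hreal
  have := hA.eqOn_of_preconnected_of_frequently_eq hB hSc (z₀ := -1) (by simp [hS]) hfreq
  rw [← hval]
  exact this hz

/-- The power function `u ↦ u ^ ρ`, extended by zero to `(-∞, 0]`. -/
noncomputable def posPow (ρ u : ℝ) : ℝ := if 0 < u then u ^ ρ else 0

theorem posPow_eq_indicator (ρ : ℝ) : posPow ρ = (Ioi 0).indicator (fun u => u ^ ρ) := by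
  ext u; simp [posPow, indicator]

theorem integrableOn_posPow {ρ : ℝ} (hρ : -1 < ρ) (b : ℝ) : IntegrableOn (posPow ρ) (Iio b) := by
  rw [posPow_eq_indicator, IntegrableOn, integrable_indicator_iff measurableSet_Ioi, IntegrableOn,
    Measure.restrict_restrict measurableSet_Ioi, Ioi_inter_Iio]
  rcases le_total b 0 with h | h
  · rw [Ioo_eq_empty (by simpa using h)]; simp
  · exact ((intervalIntegrable_iff_integrableOn_Ioo_of_le h).1
      (intervalIntegral.intervalIntegrable_rpow' hρ))

theorem measurable_posPow (ρ : ℝ) : Measurable (posPow ρ) := by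
  rw [posPow_eq_indicator]
  exact (measurable_id.pow_const ρ).indicator measurableSet_Ioi

/-- Finite differences under an exponential weight. -/
theorem integral_cexp_mul_fwdDiff_iterate {ψ : ℝ → ℝ} {z : ℂ}
    (h : Integrable fun u : ℝ => Complex.exp (z * u) * (ψ u : ℂ)) (x : ℝ) (n : ℕ) :
    Integrable (fun u : ℝ => Complex.exp (z * u) * (((fwdDiff x)^[n] ψ u : ℝ) : ℂ)) ∧
    ∫ u : ℝ, Complex.exp (z * u) * (((fwdDiff x)^[n] ψ u : ℝ) : ℂ)
      = (Complex.exp (-(z * x)) - 1) ^ n * ∫ u : ℝ, Complex.exp (z * u) * (ψ u : ℂ) := by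
  induction n with
  | zero => simpa using h
  | succ n ih =>
    set χ := (fwdDiff x)^[n] ψ with hχ
    rw [Function.iterate_succ_apply', ← hχ]
    have e : ∀ u : ℝ, Complex.exp (z * u) * ((fwdDiff x χ u : ℝ) : ℂ)
        = Complex.exp (-(z * x)) * (fun v : ℝ => Complex.exp (z * v) * (χ v : ℂ)) (u + x)
          - Complex.exp (z * u) * (χ u : ℂ) := fun u => by
      simp only [fwdDiff]
      rw [← mul_assoc, ← Complex.exp_add]
      push_cast
      rw [show -(z * x) + z * (u + x) = z * u by ring]
      ring
    simp_rw [e]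
    have hi := (ih.1.comp_add_right x).const_mul (Complex.exp (-(z * x)))
    refine ⟨hi.sub ih.1, ?_⟩
    rw [integral_sub hi ih.1, integral_const_mul,
      integral_add_right_eq_self (fun v : ℝ => Complex.exp (z * v) * (χ v : ℂ)), ih.2]
    ring

/-- Each forward difference looks ahead by `x`, so the support grows to the left by `x` every time.
-/
theorem fwdDiff_iterate_eq_zero_of_lt {ψ : ℝ → ℝ} (hψ : ∀ t ≤ 0, ψ t = 0) {x : ℝ} (n : ℕ) {u : ℝ}
    (hx : 0 ≤ x) (hu : u ≤ -(n * x)) : (fwdDiff x)^[n] ψ u = 0 := by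
  induction n generalizing u with
  | zero => exact hψ u (by simpa using hu)
  | succ n ih =>
    rw [Function.iterate_succ_apply', fwdDiff]
    push_cast at hu
    rw [ih (by linarith), ih (by linarith), sub_zero]

theorem integrable_cexp_mul_posPow {ρ : ℝ} (hρ : -1 < ρ) {z : ℂ} (hz : z.re < 0) :
    Integrable fun u : ℝ => Complex.exp (z * u) * (posPow ρ u : ℂ) := by
  have h1 := integrableOn_rpow_mul_exp_neg_mul_rpow (p := 1) (s := ρ) (b := -z.re)
      hρ one_pos (by linarith)
  have h2 := (integrable_indicator_iff measurableSet_Ioi).2 h1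
  have hm : AEStronglyMeasurable (fun u : ℝ => Complex.exp (z * u) * (posPow ρ u : ℂ)) volume :=
    (Measurable.mul (by fun_prop)
      (Complex.measurable_ofReal.comp (measurable_posPow ρ))).aestronglyMeasurable
  refine h2.mono' hm (Eventually.of_forall fun u => ?_)
  rw [posPow_eq_indicator]
  by_cases hu : u ∈ Ioi (0 : ℝ)
  · simp only [hu, indicator_of_mem, norm_mul, Complex.norm_exp, Complex.norm_real,
      Real.norm_eq_abs]
    rw [abs_of_nonneg (Real.rpow_nonneg (le_of_lt hu) _)]
    simp [mul_comm]
  · simp [hu]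

/-- The Fourier constant of a finite difference of a power does not vanish. -/
theorem integral_cexp_mul_fwdDiff_posPow_ne_zero {ρ : ℝ} (hρ : -1 < ρ) (n : ℕ)
    (hi : Integrable ((fwdDiff 1)^[n] (posPow ρ))) :
    ∫ u : ℝ, Complex.exp (Real.pi * Complex.I * u) * (((fwdDiff 1)^[n] (posPow ρ) u : ℝ) : ℂ)
      ≠ 0 := by
  set D := (fwdDiff 1)^[n] (posPow ρ) with hD
  have hD0 : ∀ u ≤ -(n : ℝ), D u = 0 := fun u hu =>
    fwdDiff_iterate_eq_zero_of_lt (fun t ht => by simp [posPow, not_lt.2 ht]) n zero_le_one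
      (by simpa using hu)
  -- Abel regularization: the weight `e^{-εu}` is at most `e^n` on the support of `D`, which lies in
  -- `u > -n`, so dominated convergence applies.
  have hlim : Tendsto (fun ε : ℝ => ∫ u : ℝ,
      Complex.exp ((Real.pi * Complex.I - ε) * u) * (D u : ℂ)) (𝓝[>] 0)
      (𝓝 (∫ u : ℝ, Complex.exp (Real.pi * Complex.I * u) * (D u : ℂ))) := by
    refine tendsto_integral_filter_of_dominated_convergence (fun u => Real.exp n * ‖D u‖) ?_ ?_
      (hi.norm.const_mul _) ?_
    · exact Eventually.of_forall fun ε =>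
        AEStronglyMeasurable.mul (by fun_prop) hi.ofReal.aestronglyMeasurable
    · have : ∀ᶠ ε : ℝ in 𝓝[>] 0, ε ∈ Ioo (0 : ℝ) 1 := Ioo_mem_nhdsGT one_pos
      filter_upwards [this] with ε hε
      refine Eventually.of_forall fun u => ?_
      rw [norm_mul, Complex.norm_real]
      rcases le_or_gt u (-n) with hu | hu
      · simp [hD0 u hu]
      · refine mul_le_mul_of_nonneg_right ?_ (norm_nonneg _)
        rw [Complex.norm_exp]
        refine Real.exp_le_exp.2 ?_
        simp only [Complex.mul_re, Complex.sub_re, Complex.ofReal_re, Complex.I_re,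
          Complex.ofReal_im, Complex.I_im, Complex.sub_im, Complex.mul_im]
        have hn : (0 : ℝ) ≤ n := n.cast_nonneg
        nlinarith [hε.1, hε.2]
    · refine Eventually.of_forall fun u => ?_
      have hc : Continuous fun ε : ℝ => Complex.exp ((Real.pi * Complex.I - ε) * u) * (D u : ℂ) := by
        fun_prop
      have := (hc.tendsto 0).mono_left (nhdsWithin_le_nhds (s := Ioi 0))
      simpa using this
  -- For `ε > 0` the power itself is integrable under the weight, so the difference factors out and
  -- the rest is the Gamma integral. Only norms are needed, which avoids branches of the complex
  -- power.
  have hval : ∀ᶠ ε : ℝ in 𝓝[>] 0, ‖∫ u : ℝ,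
      Complex.exp ((Real.pi * Complex.I - ε) * u) * (D u : ℂ)‖
      = ‖Complex.exp (-((Real.pi * Complex.I - ε) * (1 : ℝ))) - 1‖ ^ n *
        (‖1 / -(Real.pi * Complex.I - (ε : ℂ))‖ ^ (ρ + 1) * Real.Gamma (ρ + 1)) := by
    filter_upwards [self_mem_nhdsWithin] with ε hε
    rw [mem_Ioi] at hε
    have hz : ((Real.pi : ℂ) * Complex.I - ε).re < 0 := by simp [hε]
    rw [hD, (integral_cexp_mul_fwdDiff_iterate (integrable_cexp_mul_posPow hρ hz) 1 n).2,
      norm_mul, norm_pow]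
    congr 1
    have h1 := integral_cexp_mul_rpow_Ioi (a := ρ + 1) (by linarith) hz
    have h2 : ∫ u : ℝ, Complex.exp ((Real.pi * Complex.I - ε) * u) * (posPow ρ u : ℂ)
        = (1 / -(Real.pi * Complex.I - (ε : ℂ))) ^ ((ρ + 1 : ℝ) : ℂ)
          * Complex.Gamma ((ρ + 1 : ℝ) : ℂ) := by
      rw [← h1, ← integral_indicator measurableSet_Ioi]
      refine integral_congr_ae (Eventually.of_forall fun u => ?_)
      by_cases hu : u ∈ Ioi (0 : ℝ)
      · simp [posPow_eq_indicator, hu]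
      · simp [posPow_eq_indicator, hu]
    rw [h2, norm_mul, Complex.norm_cpow_real, Complex.Gamma_ofReal, Complex.norm_real,
      Real.norm_of_nonneg (Real.Gamma_pos_of_pos (by linarith)).le]
  have hlim2 : Tendsto (fun ε : ℝ =>
      ‖Complex.exp (-((Real.pi * Complex.I - ε) * (1 : ℝ))) - 1‖ ^ n *
        (‖1 / -(Real.pi * Complex.I - (ε : ℂ))‖ ^ (ρ + 1) * Real.Gamma (ρ + 1))) (𝓝[>] 0)
      (𝓝 (‖Complex.exp (-((Real.pi * Complex.I - (0 : ℝ)) * (1 : ℝ))) - 1‖ ^ n *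
        (‖1 / -(Real.pi * Complex.I - ((0 : ℝ) : ℂ))‖ ^ (ρ + 1) * Real.Gamma (ρ + 1)))) := by
    refine (ContinuousAt.tendsto ?_).mono_left nhdsWithin_le_nhds
    refine ContinuousAt.mul (by fun_prop) (ContinuousAt.mul (ContinuousAt.rpow_const ?_ ?_)
      continuousAt_const)
    · refine (ContinuousAt.div continuousAt_const (by fun_prop) ?_).norm
      simp [Real.pi_ne_zero]
    · left; simp [Real.pi_ne_zero]
  intro h0
  have h3 := hlim.norm.congr' hval
  rw [h0, norm_zero] at h3
  have h4 := tendsto_nhds_unique h3 hlim2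
  have h5 : Complex.exp (-(Real.pi * Complex.I)) = -1 := by
    rw [Complex.exp_neg, Complex.exp_pi_mul_I]; norm_num
  have hpos : 0 < ‖Complex.exp (-((Real.pi * Complex.I - (0 : ℝ)) * (1 : ℝ))) - 1‖ ^ n *
        (‖1 / -(Real.pi * Complex.I - ((0 : ℝ) : ℂ))‖ ^ (ρ + 1) * Real.Gamma (ρ + 1)) := by
    have e1 : Complex.exp (-((Real.pi * Complex.I - (0 : ℝ)) * (1 : ℝ))) - 1 = -2 := by
      rw [show -(((Real.pi : ℂ) * Complex.I - (0 : ℝ)) * (1 : ℝ)) = -(Real.pi * Complex.I) by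
        push_cast; ring, h5]
      norm_num
    rw [e1]
    refine mul_pos (by simp) (mul_pos (Real.rpow_pos_of_pos ?_ _)
      (Real.Gamma_pos_of_pos (by linarith)))
    simp [Real.pi_ne_zero]
  exact hpos.ne h4

/-! ### Rescaled finite differences and dominated convergence -/

theorem fwdDiff_iterate_comp_mul (φ : ℝ → ℝ) (x : ℝ) (n : ℕ) (u : ℝ) :
    (fwdDiff x)^[n] φ (u * x) = (fwdDiff 1)^[n] (fun v => φ (v * x)) u := by
  rw [fwdDiff_iter_eq_sum_shift, fwdDiff_iter_eq_sum_shift]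
  refine Finset.sum_congr rfl fun k _ => ?_
  simp only [nsmul_eq_mul, mul_one]
  ring_nf

theorem fwdDiff_iterate_div (φ : ℝ → ℝ) (x c : ℝ) (n : ℕ) (u : ℝ) :
    (fwdDiff x)^[n] φ u / c = (fwdDiff x)^[n] (fun v => φ v / c) u := by
  rw [fwdDiff_iter_eq_sum_shift, fwdDiff_iter_eq_sum_shift, Finset.sum_div]
  refine Finset.sum_congr rfl fun k _ => ?_
  simp only [zsmul_eq_mul]
  ring

theorem abs_fwdDiff_iterate_le (ψ : ℝ → ℝ) (n : ℕ) (u : ℝ) :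
    |(fwdDiff 1)^[n] ψ u| ≤ ∑ k ∈ Finset.range (n + 1), (n.choose k : ℝ) * |ψ (u + k)| := by
  rw [fwdDiff_iter_eq_sum_shift]
  refine (Finset.abs_sum_le_sum_abs _ _).trans (Finset.sum_le_sum fun k _ => le_of_eq ?_)
  simp [abs_mul]

theorem tendsto_fwdDiff_iterate {ι : Type*} {l : Filter ι} {ψ : ι → ℝ → ℝ} {χ : ℝ → ℝ} (x : ℝ)
    (h : ∀ u, Tendsto (fun i => ψ i u) l (𝓝 (χ u))) (n : ℕ) (u : ℝ) :
    Tendsto (fun i => (fwdDiff x)^[n] (ψ i) u) l (𝓝 ((fwdDiff x)^[n] χ u)) := by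
  induction n generalizing u with
  | zero => exact h u
  | succ n ih =>
    simp only [Function.iterate_succ_apply', fwdDiff]
    exact (ih _).sub (ih _)

theorem aestronglyMeasurable_comp_mul_right {φ : ℝ → ℝ} (hφ : AEStronglyMeasurable φ volume)
    {x : ℝ} (hx : x ≠ 0) : AEStronglyMeasurable (fun u => φ (u * x)) volume := by
  refine hφ.comp_quasiMeasurePreserving ⟨measurable_id.mul_const x, ?_⟩
  rw [Real.map_volume_mul_right hx]
  exact Measure.smul_absolutelyContinuous

theorem aestronglyMeasurable_fwdDiff_iterate {φ : ℝ → ℝ} (hφ : AEStronglyMeasurable φ volume)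
    (x : ℝ) (n : ℕ) : AEStronglyMeasurable ((fwdDiff x)^[n] φ) volume := by
  induction n with
  | zero => exact hφ
  | succ n ih =>
    rw [Function.iterate_succ_apply']
    exact (ih.comp_measurePreserving (measurePreserving_add_right volume x)).sub ih

theorem RegVarAtZero.tendsto_ratio_posPow {φ : ℝ → ℝ} {ρ : ℝ} (hφ : RegVarAtZero φ ρ)
    (hz : ∀ t ≤ 0, φ t = 0) (u : ℝ) :
    Tendsto (fun x => φ (u * x) / φ x) (𝓝[>] 0) (𝓝 (posPow ρ u)) := by
  rcases lt_or_ge 0 u with hu | hu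
  · simpa [posPow, hu] using hφ.tendsto_ratio hu
  · refine tendsto_const_nhds.congr' ?_
    filter_upwards [self_mem_nhdsWithin] with x hx
    rw [hz _ (mul_nonpos_of_nonpos_of_nonneg hu (le_of_lt hx))]
    simp [posPow, not_lt.2 hu]

/-- The Fourier integral of a finite difference of a regularly varying function, rescaled, converges
if the finite differences are dominated away from zero. -/
theorem RegVarAtZero.tendsto_integral_fwdDiff {φ : ℝ → ℝ} {ρ : ℝ} (hφ : RegVarAtZero φ ρ)
    (hρ : -1 < ρ) (hz : ∀ t ≤ 0, φ t = 0) (hm : AEStronglyMeasurable φ volume) (n : ℕ)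
    {Q : ℝ → ℝ} (hQ : IntegrableOn Q (Ici 1)) {δ : ℝ} (hδ : 0 < δ)
    (hdom : ∀ x, 0 < x → x ≤ δ → ∀ u, 1 ≤ u → |(fwdDiff x)^[n] φ (u * x)| ≤ φ x * Q u) :
    Integrable ((fwdDiff 1)^[n] (posPow ρ)) ∧
    Tendsto (fun x : ℝ => ∫ u : ℝ, Complex.exp (Real.pi * Complex.I * u) *
      (((fwdDiff x)^[n] φ (u * x) / φ x : ℝ) : ℂ)) (𝓝[>] 0)
      (𝓝 (∫ u : ℝ, Complex.exp (Real.pi * Complex.I * u) *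
        (((fwdDiff 1)^[n] (posPow ρ) u : ℝ) : ℂ))) := by
  -- Half the distance of `ρ` from `-1`, so that both Potter exponents `ρ ± ε` stay above `-1` and
  -- the majorant is integrable at zero.
  set ε : ℝ := (ρ + 1) / 2 with hε
  have hε0 : 0 < ε := by rw [hε]; linarith
  obtain ⟨δ', C, hδ', hC, hpot⟩ := hφ.potter hε0
  set pp : ℝ → ℝ := fun v => posPow (ρ - ε) v + posPow (ρ + ε) v with hpp
  have hppi : ∀ b, IntegrableOn pp (Iio b) := fun b =>
    (integrableOn_posPow (by rw [hε]; linarith) b).add (integrableOn_posPow (by linarith) b)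
  set S : ℝ → ℝ := fun u => ∑ k ∈ Finset.range (n + 1), (n.choose k : ℝ) * (C * pp (u + k)) with hS
  have hSi : IntegrableOn S (Iio 1) := by
    refine integrable_finsetSum _ fun k _ => (Integrable.const_mul ?_ _).const_mul _
    have h1 := (integrable_indicator_iff measurableSet_Iio).2 (hppi (1 + k))
    have h2 := h1.comp_add_right (k : ℝ)
    refine (integrable_indicator_iff measurableSet_Iio).1 (h2.congr (Eventually.of_forall fun u => ?_))
    simp [indicator]
  set B : ℝ → ℝ := fun u => (Ici 1).indicator Q u + (Iio 1).indicator S u with hB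
  have hBi : Integrable B :=
    ((integrable_indicator_iff measurableSet_Ici).2 hQ).add
      ((integrable_indicator_iff measurableSet_Iio).2 hSi)
  have hscale : ∀ x u, (fwdDiff x)^[n] φ (u * x) / φ x
      = (fwdDiff 1)^[n] (fun v => φ (v * x) / φ x) u := fun x u => by
    rw [fwdDiff_iterate_comp_mul, fwdDiff_iterate_div]
  have hpt : ∀ u, Tendsto (fun x => (fwdDiff x)^[n] φ (u * x) / φ x) (𝓝[>] 0)
      (𝓝 ((fwdDiff 1)^[n] (posPow ρ) u)) := fun u => by
    simp_rw [hscale]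
    exact tendsto_fwdDiff_iterate 1 (fun v => hφ.tendsto_ratio_posPow hz v) n u
  -- For `u < 1` and `k ≤ n` the points `(u + k) x` must remain in the range `(0, δ']` of Potter's
  -- bounds whenever they are positive.
  set η := min δ (δ' / (n + 1)) with hη
  have hη0 : 0 < η := lt_min hδ (by positivity)
  have hbound : ∀ x, 0 < x → x ≤ η → ∀ u, |(fwdDiff x)^[n] φ (u * x) / φ x| ≤ B u := by
    intro x hx hxη u
    have hn1 : (1 : ℝ) ≤ n + 1 := by linarith [n.cast_nonneg (α := ℝ)]
    have hxn : (n + 1) * x ≤ δ' := by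
      have := hxη.trans (min_le_right _ _)
      rw [le_div_iff₀ (by positivity)] at this
      linarith
    have hxδ' : x ≤ δ' := by nlinarith
    have hφx : 0 < φ x := (hpot x x hx hxδ' hx hxδ').1
    rcases le_or_gt 1 u with hu | hu
    · simp only [hB, indicator, mem_Ici, mem_Iio, hu, if_true, not_lt.2 hu, if_false, add_zero]
      rw [abs_div, abs_of_pos hφx, div_le_iff₀ hφx, mul_comm (Q u)]
      exact hdom x hx (hxη.trans (min_le_left _ _)) u hu
    · simp only [hB, indicator, mem_Ici, mem_Iio, not_le.2 hu, if_true, hu, if_false, zero_add]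
      rw [hscale]
      refine (abs_fwdDiff_iterate_le _ n u).trans (Finset.sum_le_sum fun k hk => ?_)
      refine mul_le_mul_of_nonneg_left ?_ (Nat.cast_nonneg _)
      rcases le_or_gt (u + k) 0 with h0 | h0
      · rw [hz _ (mul_nonpos_of_nonpos_of_nonneg h0 hx.le)]
        simp [hpp, posPow, not_lt.2 h0]
      · have hk' : (k : ℝ) ≤ n := by exact_mod_cast Nat.lt_succ_iff.1 (Finset.mem_range.1 hk)
        have hy : (u + k) * x ≤ δ' := by nlinarith
        have h1 := hpot x ((u + k) * x) hx hxδ' (by positivity) hy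
        have h2 := (hpot ((u + k) * x) x (by positivity) hy hx hxδ').1
        rw [abs_of_pos (div_pos h2 hφx), div_le_iff₀ hφx]
        refine h1.2.trans (le_of_eq ?_)
        rw [mul_div_cancel_right₀ _ hx.ne']
        simp [hpp, posPow, h0]
  have hmeas : ∀ x, 0 < x → AEStronglyMeasurable
      (fun u => (fwdDiff x)^[n] φ (u * x) / φ x) volume := fun x hx => by
    have h1 := aestronglyMeasurable_fwdDiff_iterate
      ((aestronglyMeasurable_comp_mul_right hm hx.ne').mul_const (φ x)⁻¹) 1 n
    refine h1.congr (Eventually.of_forall fun u => ?_)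
    simp only [hscale, div_eq_mul_inv]
  have hev : ∀ᶠ x : ℝ in 𝓝[>] 0, 0 < x ∧ x ≤ η := by
    filter_upwards [Ioc_mem_nhdsGT hη0] with x hx using hx
  constructor
  · refine hBi.mono' (aestronglyMeasurable_fwdDiff_iterate
      (measurable_posPow ρ).aestronglyMeasurable 1 n) (Eventually.of_forall fun u => ?_)
    exact le_of_tendsto (hpt u).abs (hev.mono fun x hx => hbound x hx.1 hx.2 u)
  · refine tendsto_integral_filter_of_dominated_convergence B ?_ ?_ hBi ?_
    · filter_upwards [hev] with x hx
      exact AEStronglyMeasurable.mul (by fun_prop)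
        (Complex.continuous_ofReal.comp_aestronglyMeasurable (hmeas x hx.1))
    · filter_upwards [hev] with x hx
      refine Eventually.of_forall fun u => ?_
      rw [norm_mul, Complex.norm_real, show (Real.pi : ℂ) * Complex.I * u
        = ((Real.pi * u : ℝ) : ℂ) * Complex.I by push_cast; ring, Complex.norm_exp_ofReal_mul_I,
        one_mul]
      exact hbound x hx.1 hx.2 u
    · exact Eventually.of_forall fun u =>
        ((Complex.continuous_ofReal.tendsto _).comp (hpt u)).const_mul _

/-! ### Domination of higher differences from (A3) -/

/-- Domination of second differences extracted from the bound on `secondDiffSup`. -/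
theorem SecondDiffCondition.exists_dominating {h : ℝ → ℝ} (hh : SecondDiffCondition h) :
    ∃ (x₀ : ℝ) (Q : ℝ → ℝ), 0 < x₀ ∧ IntegrableOn Q (Ici 1) ∧
      ∀ x, 0 < x → x ≤ x₀ → ∀ u, 1 ≤ u → |(fwdDiff x)^[2] h (u * x)| ≤ |h x| * Q u := by
  obtain ⟨x₀, hx₀, hne, ⟨C, hC⟩, hmeas, hint⟩ := hh
  refine ⟨x₀, fun u => (secondDiffSup h x₀ u).toReal, hx₀,
    integrable_toReal_of_lintegral_ne_top hmeas hint.ne, fun x hx hxx u hu => ?_⟩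
  have hfin : secondDiffSup h x₀ u ≠ ⊤ := ne_top_of_le_ne_top ENNReal.coe_ne_top (hC u hu)
  have h1 : ENNReal.ofReal
      |(h ((u + 1 + 1) * x) - h ((u + 1) * x) - h ((u + 1) * x) + h (u * x)) / h x|
      ≤ secondDiffSup h x₀ u := by
    unfold secondDiffSup
    refine le_iSup_of_le x (le_iSup_of_le 1 (le_iSup_of_le 1 (le_iSup_of_le ?_ le_rfl)))
    exact ⟨hx, hxx, zero_le_one, le_rfl, le_rfl⟩
  have h2 := (ENNReal.ofReal_le_iff_le_toReal hfin).1 h1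
  rw [abs_div, div_le_iff₀ (abs_pos.2 (hne x hx hxx)), mul_comm (ENNReal.toReal _)] at h2
  refine le_trans (le_of_eq ?_) h2
  simp only [Function.iterate_succ, Function.iterate_zero, Function.comp, id, fwdDiff]
  rw [show u * x + x + x = (u + 1 + 1) * x by ring, show u * x + x = (u + 1) * x by ring]
  congr 1; ring

/-- Averages of an integrable function over unit windows are integrable. -/
theorem integrableOn_window {Q : ℝ → ℝ} (hQ : IntegrableOn Q (Ici 1)) :
    IntegrableOn (fun u => ∫ s in u..(u + 1), Q s) (Ici 1) := by
  have hQ' : Integrable ((Ici (1 : ℝ)).indicator Q) :=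
    (integrable_indicator_iff measurableSet_Ici).2 hQ
  -- The window integral is the convolution of `Q` with this indicator, and a convolution of
  -- integrable functions is integrable.
  have hI : Integrable ((Ico (-1 : ℝ) 0).indicator (fun _ => (1 : ℝ))) :=
    (integrable_indicator_iff measurableSet_Ico).2 (integrableOn_const (by simp))
  have hc := hI.integrable_convolution (ContinuousLinearMap.mul ℝ ℝ) hQ'
  refine hc.integrableOn.congr ?_
  filter_upwards [ae_restrict_mem measurableSet_Ici] with u hu
  rw [mem_Ici] at hu
  have e1 : ∀ t, ContinuousLinearMap.mul ℝ ℝ ((Ico (-1 : ℝ) 0).indicator (fun _ => (1 : ℝ)) t)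
      ((Ici (1 : ℝ)).indicator Q (u - t)) = (fun s => (Ioc u (u + 1)).indicator Q s) (u - t) := by
    intro t
    simp only [ContinuousLinearMap.mul_apply', indicator, mem_Ico, mem_Ici, mem_Ioc]
    by_cases ht : -1 ≤ t ∧ t < 0
    · have : u < u - t ∧ u - t ≤ u + 1 := ⟨by linarith, by linarith⟩
      rw [if_pos ht, if_pos this, if_pos (by linarith), one_mul]
    · have : ¬ (u < u - t ∧ u - t ≤ u + 1) := fun hh => ht ⟨by linarith, by linarith⟩
      rw [if_neg ht, if_neg this, zero_mul]
  rw [convolution, integral_congr_ae (Eventually.of_forall e1), integral_sub_left_eq_self,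
    integral_indicator measurableSet_Ioc, intervalIntegral.integral_of_le (by linarith)]

theorem hasDerivAt_fwdDiff {ψ ψ' : ℝ → ℝ} (hψ : ∀ t, 0 < t → HasDerivAt ψ (ψ' t) t) {x : ℝ}
    (hx : 0 ≤ x) {t : ℝ} (ht : 0 < t) : HasDerivAt (fwdDiff x ψ) (fwdDiff x ψ' t) t :=
  ((hψ (t + x) (by linarith)).comp_add_const t x).sub (hψ t ht)

theorem hasDerivAt_fwdDiff_iterate {ψ ψ' : ℝ → ℝ} (hψ : ∀ t, 0 < t → HasDerivAt ψ (ψ' t) t)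
    {x : ℝ} (hx : 0 ≤ x) (n : ℕ) {t : ℝ} (ht : 0 < t) :
    HasDerivAt ((fwdDiff x)^[n] ψ) ((fwdDiff x)^[n] ψ' t) t := by
  induction n generalizing t with
  | zero => exact hψ t ht
  | succ n ih =>
    simp only [Function.iterate_succ_apply']
    exact hasDerivAt_fwdDiff (fun t ht => ih ht) hx ht

/-- A difference is bounded by the window average of a bound on the derivative. -/
theorem abs_fwdDiff_le_of_hasDerivAt {ψ ψ' : ℝ → ℝ} (hψ : ∀ t, 0 < t → HasDerivAt ψ (ψ' t) t)
    {Q : ℝ → ℝ} (hQ : IntegrableOn Q (Ici 1)) {x : ℝ} (hx : 0 < x)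
    (hb : ∀ u, 1 ≤ u → |ψ' (u * x)| ≤ Q u) {u : ℝ} (hu : 1 ≤ u) :
    |fwdDiff x ψ (u * x)| ≤ x * ∫ s in u..(u + 1), Q s := by
  have hQi : IntervalIntegrable Q volume u (u + 1) := by
    rw [intervalIntegrable_iff_integrableOn_Ioc_of_le (by linarith)]
    exact hQ.mono_set fun s hs => hu.trans hs.1.le
  have hd : ∀ s ∈ uIcc u (u + 1), HasDerivAt (fun s => ψ (s * x)) (ψ' (s * x) * x) s := by
    intro s hs
    rw [uIcc_of_le (by linarith)] at hs
    have h0 : 0 < s * x := mul_pos (by linarith [hs.1]) hx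
    exact (hψ _ h0).comp s (by simpa using (hasDerivAt_id s).mul_const x)
  have hbd : ∀ s ∈ Ioc u (u + 1), ‖ψ' (s * x) * x‖ ≤ x * Q s := by
    intro s hs
    rw [norm_mul, Real.norm_eq_abs, Real.norm_of_nonneg hx.le, mul_comm]
    exact mul_le_mul_of_nonneg_left (hb s (hu.trans hs.1.le)) hx.le
  have hint : IntervalIntegrable (fun s => ψ' (s * x) * x) volume u (u + 1) := by
    rw [intervalIntegrable_iff_integrableOn_Ioc_of_le (by linarith)] at hQi ⊢
    refine (hQi.const_mul x).mono' ?_ ?_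
    -- No regularity of `ψ'` is assumed: it is measurable here because it agrees with `deriv ψ` on
    -- the positive half line.
    · have h1 : Measurable (fun s => deriv ψ (s * x) * x) :=
        ((measurable_deriv ψ).comp (measurable_id.mul_const x)).mul_const x
      refine h1.aestronglyMeasurable.congr ?_
      filter_upwards [ae_restrict_mem measurableSet_Ioc] with s hs
      rw [(hψ (s * x) (mul_pos (by linarith [hs.1]) hx)).deriv]
    · filter_upwards [ae_restrict_mem measurableSet_Ioc] with s hs using hbd s hs
  have hftc := intervalIntegral.integral_eq_sub_of_hasDerivAt hd hint
  rw [fwdDiff, show u * x + x = (u + 1) * x by ring, ← hftc, ← Real.norm_eq_abs,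
    ← intervalIntegral.integral_const_mul]
  exact intervalIntegral.norm_integral_le_of_norm_le (by linarith)
    (Eventually.of_forall hbd) (hQi.const_mul x)

theorem HasDerivsAt.hasDerivAt {g : ℝ → ℝ} {k : ℕ} {t : ℝ} (h : HasDerivsAt g k t) {j : ℕ}
    (hj : j < k) : HasDerivAt (iteratedDeriv j g) (iteratedDeriv (j + 1) g t) t := by
  rw [iteratedDeriv_succ]
  exact (h j (by exact_mod_cast hj)).hasDerivAt

/-- Domination of the second differences of the `k`-th derivative yields domination of the
differences of order `k + 2`. -/
theorem exists_dominating_fwdDiff {g : ℝ → ℝ} {k : ℕ} (hd : ∀ t, 0 < t → HasDerivsAt g k t)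
    {x₀ : ℝ} {Q : ℝ → ℝ} (hQ : IntegrableOn Q (Ici 1))
    (hdom : ∀ x, 0 < x → x ≤ x₀ → ∀ u, 1 ≤ u →
      |(fwdDiff x)^[2] (iteratedDeriv k g) (u * x)| ≤ |iteratedDeriv k g x| * Q u) :
    ∃ R : ℝ → ℝ, IntegrableOn R (Ici 1) ∧ ∀ x, 0 < x → x ≤ x₀ → ∀ u, 1 ≤ u →
      |(fwdDiff x)^[k + 2] g (u * x)| ≤ x ^ k * |iteratedDeriv k g x| * R u := by
  -- Going down one derivative costs one more difference, gains a factor `x`, and replaces the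
  -- majorant by its window average.
  have key : ∀ j : ℕ, j ≤ k → ∃ R : ℝ → ℝ, IntegrableOn R (Ici 1) ∧ ∀ x, 0 < x → x ≤ x₀ →
      ∀ u, 1 ≤ u → |(fwdDiff x)^[j + 2] (iteratedDeriv (k - j) g) (u * x)|
        ≤ x ^ j * |iteratedDeriv k g x| * R u := by
    intro j
    induction j with
    | zero => intro _; exact ⟨Q, hQ, fun x hx hxx u hu => by simpa using hdom x hx hxx u hu⟩
    | succ j ih =>
      intro hj
      obtain ⟨R, hR, hRb⟩ := ih (by omega)
      refine ⟨_, integrableOn_window hR, fun x hx hxx u hu => ?_⟩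
      have hder : ∀ t, 0 < t → HasDerivAt ((fwdDiff x)^[j + 2] (iteratedDeriv (k - (j + 1)) g))
          ((fwdDiff x)^[j + 2] (iteratedDeriv (k - j) g) t) t := fun t ht => by
        refine hasDerivAt_fwdDiff_iterate (fun t ht => ?_) hx.le _ ht
        have := (hd t ht).hasDerivAt (j := k - (j + 1)) (by omega)
        rwa [show k - (j + 1) + 1 = k - j by omega] at this
      have h1 := abs_fwdDiff_le_of_hasDerivAt hder
        (hR.const_mul (x ^ j * |iteratedDeriv k g x|)) hx (fun u hu => hRb x hx hxx u hu) hu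
      rw [intervalIntegral.integral_const_mul] at h1
      rw [show j + 1 + 2 = (j + 2) + 1 by ring, Function.iterate_succ_apply']
      refine h1.trans (le_of_eq ?_)
      ring
  obtain ⟨R, hR, hRb⟩ := key k le_rfl
  exact ⟨R, hR, by simpa using hRb⟩

/-- An iterated mean value inequality. -/
theorem le_fwdDiff_iterate_of_le_iteratedDeriv {g : ℝ → ℝ} {k : ℕ}
    (hd : ∀ t, 0 < t → HasDerivsAt g k t) {x m : ℝ} (hx : 0 < x)
    (hm : ∀ t, x ≤ t → t ≤ (k + 1) * x → m ≤ iteratedDeriv k g t) :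
    m * x ^ k ≤ (fwdDiff x)^[k] g x := by
  -- Each application of the mean value theorem trades one difference for a derivative and a factor
  -- `x`; the points used never leave `[x, (k + 1) x]`.
  have key : ∀ j : ℕ, j ≤ k → ∀ t, x ≤ t → t + j * x ≤ (k + 1) * x →
      m * x ^ j ≤ (fwdDiff x)^[j] (iteratedDeriv (k - j) g) t := by
    intro j
    induction j with
    | zero => intro _ t h1 h2; simpa using hm t h1 (by simpa using h2)
    | succ j ih =>
      intro hj t h1 h2
      push_cast at h2
      have hder : ∀ s, 0 < s → HasDerivAt ((fwdDiff x)^[j] (iteratedDeriv (k - (j + 1)) g))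
          ((fwdDiff x)^[j] (iteratedDeriv (k - j) g) s) s := fun s hs => by
        refine hasDerivAt_fwdDiff_iterate (fun t ht => ?_) hx.le _ hs
        have := (hd t ht).hasDerivAt (j := k - (j + 1)) (by omega)
        rwa [show k - (j + 1) + 1 = k - j by omega] at this
      have htx : t < t + x := by linarith
      obtain ⟨c, hc, hceq⟩ := exists_hasDerivAt_eq_slope _ _ htx
        (fun s hs => (hder s (by linarith [hs.1])).continuousAt.continuousWithinAt)
        (fun s hs => hder s (by linarith [hs.1]))
      have h3 := ih (by omega) c (by linarith [hc.1]) (by linarith [hc.2])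
      rw [hceq, add_sub_cancel_left, le_div_iff₀ hx] at h3
      rw [Function.iterate_succ_apply', fwdDiff, pow_succ]
      linarith
  have := key k le_rfl x le_rfl (by linarith)
  simpa using this

/-- If the `k`-th derivative is regularly varying with index in `[0, 1)`, then it is controlled by
the function itself. -/
theorem eventually_pow_mul_iteratedDeriv_le {g : ℝ → ℝ} {k : ℕ} {ρ α : ℝ}
    (hd : ∀ t, 0 < t → HasDerivsAt g k t) (hg : RegVarAtZero g ρ) (hz : ∀ t ≤ 0, g t = 0)
    (hα0 : 0 ≤ α) (hα : RegVarAtZero (iteratedDeriv k g) α) :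
    ∃ C : ℝ, 0 < C ∧ ∀ᶠ x in 𝓝[>] (0 : ℝ), x ^ k * |iteratedDeriv k g x| ≤ C * g x := by
  obtain ⟨δ, C, hδ, hC, hpot⟩ := hα.potter one_pos
  -- For `t` in `[x, (k + 1) x]`, Potter's bound with `ε = 1` has `(x / t)^(α + 1) ≤ 1` and `(x /
  -- t)^(α - 1) ≤ k + 1`, so the derivative at `x` is at most `K` times its value at `t`.
  set K : ℝ := C * (k + 2) with hK
  have hKpos : 0 < K := by positivity
  set D : ℝ := (fwdDiff 1)^[k] (posPow ρ) 1 with hD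
  -- Regular variation of `g` bounds its `k`-th difference at `x` from above by a multiple of `g x`;
  -- the mean value inequality bounds it from below by the derivative.
  have h1 : ∀ᶠ x in 𝓝[>] (0 : ℝ), (fwdDiff x)^[k] g x / g x < |D| + 1 := by
    have h2 : Tendsto (fun x => (fwdDiff x)^[k] g (1 * x) / g x) (𝓝[>] 0) (𝓝 D) := by
      simp_rw [fwdDiff_iterate_comp_mul, fwdDiff_iterate_div]
      exact tendsto_fwdDiff_iterate 1 (fun v => hg.tendsto_ratio_posPow hz v) k 1
    simp_rw [one_mul] at h2
    exact h2.eventually_lt_const ((le_abs_self D).trans_lt (by linarith))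
  have h2 : ∀ᶠ x in 𝓝[>] (0 : ℝ), x ∈ Ioc 0 (δ / (k + 1)) := Ioc_mem_nhdsGT (by positivity)
  refine ⟨K * (|D| + 1), by positivity, ?_⟩
  filter_upwards [h1, h2, hg.eventually_pos] with x hx1 hx2 hgx
  have hx0 : 0 < x := hx2.1
  have hkx : (k + 1) * x ≤ δ := by
    have := hx2.2
    rw [le_div_iff₀ (by positivity)] at this
    linarith
  have hk0 : (0 : ℝ) ≤ k := k.cast_nonneg
  have hxδ : x ≤ δ := by nlinarith
  have hhx : 0 < iteratedDeriv k g x := (hpot x x hx0 hxδ hx0 hxδ).1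
  have h3 := le_fwdDiff_iterate_of_le_iteratedDeriv hd (m := iteratedDeriv k g x / K) hx0 ?_
  · rw [div_lt_iff₀ hgx] at hx1
    have h4 : iteratedDeriv k g x / K * x ^ k ≤ (|D| + 1) * g x := h3.trans hx1.le
    rw [div_mul_eq_mul_div, div_le_iff₀ hKpos] at h4
    rw [abs_of_pos hhx]
    linarith
  · intro t ht1 ht2
    have ht0 : 0 < t := by linarith
    have h4 := (hpot t x ht0 (ht2.trans hkx) hx0 hxδ)
    rw [div_le_iff₀ hKpos]
    have hr0 : 0 < x / t := div_pos hx0 ht0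
    have hr1 : x / t ≤ 1 := (div_le_one ht0).2 ht1
    have e1 : (x / t) ^ (α + 1) ≤ 1 := Real.rpow_le_one hr0.le hr1 (by linarith)
    have e2 : (x / t) ^ (α - 1) ≤ k + 1 := by
      have : (x / t) ^ (α - 1) ≤ (x / t) ^ (-1 : ℝ) :=
        Real.rpow_le_rpow_of_exponent_ge hr0 hr1 (by linarith)
      refine this.trans ?_
      rw [Real.rpow_neg_one, inv_div, div_le_iff₀ hx0]
      exact ht2
    refine h4.2.trans ?_
    rw [mul_comm]
    refine mul_le_mul_of_nonneg_left ?_ h4.1.le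
    rw [hK]
    exact mul_le_mul_of_nonneg_left (by linarith) hC.le

/-! ### Fourier asymptotics from dominated differences of the kernel -/

theorem locallyIntegrable_comp_add_right {φ : ℝ → ℝ} (hφ : LocallyIntegrable φ) (c : ℝ) :
    LocallyIntegrable (fun t => φ (t + c)) := by
  rw [locallyIntegrable_iff] at hφ ⊢
  intro K hK
  have h1 := hφ _ (hK.image (continuous_add_const c))
  have h2 := ((measurePreserving_add_right volume c).integrableOn_comp_preimage
    (measurableEmbedding_addRight c) (f := φ)).2 h1
  rwa [preimage_image_eq _ (add_left_injective c)] at h2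

theorem locallyIntegrable_fwdDiff_iterate {φ : ℝ → ℝ} (hφ : LocallyIntegrable φ) (x : ℝ) (n : ℕ) :
    LocallyIntegrable ((fwdDiff x)^[n] φ) := by
  induction n with
  | zero => exact hφ
  | succ n ih =>
    rw [Function.iterate_succ_apply']
    exact (locallyIntegrable_comp_add_right ih x).sub ih

/-- A finite difference that is dominated away from zero is integrable. -/
theorem integrable_fwdDiff_iterate {φ : ℝ → ℝ} (hφ : LocallyIntegrable φ)
    (hz : ∀ t ≤ 0, φ t = 0) {n : ℕ} {Q : ℝ → ℝ} (hQ : IntegrableOn Q (Ici 1)) {x c : ℝ}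
    (hx : 0 < x) (hdom : ∀ u, 1 ≤ u → |(fwdDiff x)^[n] φ (u * x)| ≤ c * Q u) :
    Integrable ((fwdDiff x)^[n] φ) := by
  have hloc := locallyIntegrable_fwdDiff_iterate hφ x n
  have h1 : IntegrableOn ((fwdDiff x)^[n] φ) (Iic (-(n * x))) :=
    integrableOn_zero.congr_fun
      (fun t ht => (fwdDiff_iterate_eq_zero_of_lt hz n hx.le ht).symm) measurableSet_Iic
  have h2 : IntegrableOn ((fwdDiff x)^[n] φ) (Icc (-(n * x)) x) :=
    hloc.integrableOn_isCompact isCompact_Icc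
  have h3 : IntegrableOn ((fwdDiff x)^[n] φ) (Ici x) := by
    have h4 : Integrable ((Ici (1 : ℝ)).indicator Q) :=
      (integrable_indicator_iff measurableSet_Ici).2 hQ
    refine ((h4.comp_div hx.ne').const_mul c).integrableOn.mono'
      hloc.aestronglyMeasurable.restrict ?_
    filter_upwards [ae_restrict_mem measurableSet_Ici] with t ht
    have h5 : 1 ≤ t / x := (one_le_div hx).2 ht
    have h6 := hdom (t / x) h5
    rw [div_mul_cancel₀ _ hx.ne'] at h6
    simpa [indicator, h5] using h6
  rw [← integrableOn_univ]
  refine ((h1.union h2).union h3).mono_set fun t _ => ?_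
  rcases le_total t (-(n * x)) with h | h
  · exact Or.inl (Or.inl h)
  · rcases le_total t x with h' | h'
    · exact Or.inl (Or.inr ⟨h, h'⟩)
    · exact Or.inr h'

/-- The exponential equals `1` only if `ω x` is a multiple of `2π`, which `0 < |ω| x ≤ π` excludes.
The bound is generous enough to include `ω = π / x`. -/
theorem cexp_sub_one_ne_zero {ω x : ℝ} (hω : ω ≠ 0) (hx : 0 < x) (hxω : x ≤ Real.pi / |ω|) :
    Complex.exp (-(Complex.I * ω * x)) - 1 ≠ 0 := by
  intro h
  rw [sub_eq_zero, Complex.exp_eq_one_iff] at h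
  obtain ⟨n, hn⟩ := h
  have h1 : -(ω * x) = n * (2 * Real.pi) := by
    have := congrArg Complex.im hn
    simpa using this
  have hω' : 0 < |ω| := abs_pos.2 hω
  have h2 : |ω| * x ≤ Real.pi := by
    rw [le_div_iff₀ hω'] at hxω; linarith
  have h3 : |ω| * x = |(n : ℝ)| * (2 * Real.pi) := by
    rw [← abs_of_pos hx, ← abs_mul, ← abs_neg, h1, abs_mul, abs_of_pos Real.two_pi_pos]
  have h4 : n ≠ 0 := by
    rintro rfl
    simp [hω, hx.ne'] at h1
  have h5 : (1 : ℝ) ≤ |(n : ℝ)| := by exact_mod_cast Int.one_le_abs h4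
  nlinarith [Real.pi_pos]

theorem cexp_neg_I_mul_pi_div {x : ℝ} (hx : 0 < x) :
    Complex.exp (-(Complex.I * (Real.pi / x : ℝ) * x)) - 1 = -2 := by
  have : -(Complex.I * ((Real.pi / x : ℝ) : ℂ) * x) = -(Real.pi * Complex.I) := by
    have hx' : (x : ℂ) ≠ 0 := by exact_mod_cast hx.ne'
    push_cast; field_simp
  rw [this, Complex.exp_neg, Complex.exp_pi_mul_I]; norm_num

theorem integral_cexp_pi_div {f : ℝ → ℝ} {x : ℝ} (hx : 0 < x) :
    ∫ t : ℝ, Complex.exp (Complex.I * (Real.pi / x : ℝ) * (t : ℂ)) * (f t : ℂ)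
      = x * ∫ u : ℝ, Complex.exp (Real.pi * Complex.I * u) * (f (u * x) : ℂ) := by
  have h := Measure.integral_comp_mul_right (fun t : ℝ =>
    Complex.exp (Complex.I * (Real.pi / x : ℝ) * (t : ℂ)) * (f t : ℂ)) x
  have hx' : (x : ℂ) ≠ 0 := by exact_mod_cast hx.ne'
  have e : ∀ u : ℝ, Complex.exp (Complex.I * (Real.pi / x : ℝ) * ((u * x : ℝ) : ℂ)) * (f (u * x) : ℂ)
      = Complex.exp (Real.pi * Complex.I * u) * (f (u * x) : ℂ) := fun u => by
    congr 2
    push_cast; field_simp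
  simp_rw [e] at h
  rw [h, abs_of_pos (inv_pos.2 hx), Complex.real_smul, ← mul_assoc]
  push_cast
  rw [mul_inv_cancel₀ hx', one_mul]

theorem integral_cexp_mul_div {f : ℝ → ℝ} (x c : ℝ) :
    ∫ u : ℝ, Complex.exp (Real.pi * Complex.I * u) * ((f (u * x) / c : ℝ) : ℂ)
      = (∫ u : ℝ, Complex.exp (Real.pi * Complex.I * u) * (f (u * x) : ℂ)) / c := by
  rw [← integral_div]
  refine integral_congr_ae (Eventually.of_forall fun u => ?_)
  simp only
  push_cast
  rw [mul_div_assoc]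

/-- Existence of the Fourier transform and its behaviour at infinity for a regularly varying kernel
with dominated finite differences. -/
theorem RegVarAtZero.fourier_asymptotics {g : ℝ → ℝ} {ρ : ℝ} (hg : RegVarAtZero g ρ)
    (hρ : -1 < ρ) (h2 : MemLp g 2 volume) (hz : ∀ t ≤ 0, g t = 0) {n : ℕ}
    {Q : ℝ → ℝ} (hQ : IntegrableOn Q (Ici 1)) {δ : ℝ} (hδ : 0 < δ)
    (hdom : ∀ x, 0 < x → x ≤ δ → ∀ u, 1 ≤ u → |(fwdDiff x)^[n] g (u * x)| ≤ g x * Q u) :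
    (∀ ω : ℝ, ω ≠ 0 → HasFourierValue g ω (kernelFourier g ω)) ∧
    ∃ c : ℝ, 0 < c ∧ Tendsto (fun x : ℝ => ‖kernelFourier g ((Real.pi / x : ℝ) : ℂ)‖ / (x * g x))
      (𝓝[>] 0) (𝓝 c) := by
  have hloc : LocallyIntegrable g := h2.locallyIntegrable (by norm_num)
  have hval : ∀ ω x : ℝ, ω ≠ 0 → 0 < x → x ≤ δ → x ≤ Real.pi / |ω| → HasFourierValue g ω
      ((∫ t : ℝ, Complex.exp (Complex.I * ω * (t : ℂ)) * (((fwdDiff x)^[n] g t : ℝ) : ℂ))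
        / (Complex.exp (-(Complex.I * ω * x)) - 1) ^ n) := fun ω x hω hx hxδ hxω =>
    hasFourierValue_of_fwdDiff_iterate h2 (cexp_sub_one_ne_zero hω hx hxω) n
      (hasFourierValue_of_integrable (integrable_fwdDiff_iterate hloc hz hQ hx (hdom x hx hxδ)) ω)
  constructor
  · intro ω hω
    have hx : 0 < min δ (Real.pi / |ω|) := lt_min hδ (div_pos Real.pi_pos (abs_pos.2 hω))
    have h3 := hval ω _ hω hx (min_le_left _ _) (min_le_right _ _)
    rw [h3.kernelFourier_eq]
    exact h3
  · obtain ⟨hKi, hK⟩ := hg.tendsto_integral_fwdDiff hρ hz hloc.aestronglyMeasurable n hQ hδ hdom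
    have hK0 := integral_cexp_mul_fwdDiff_posPow_ne_zero hρ n hKi
    refine ⟨_, div_pos (norm_pos_iff.2 hK0) (pow_pos two_pos n), ?_⟩
    -- The `2 ^ n` is the modulus of `(-2)^n`, the `n`-th power of the difference factor at
    -- frequency `π / x`.
    refine (hK.norm.div_const (2 ^ n)).congr' ?_
    filter_upwards [Ioc_mem_nhdsGT hδ, hg.eventually_pos] with x hx hgx
    have hx0 : 0 < x := hx.1
    have hω : Real.pi / x ≠ 0 := (div_pos Real.pi_pos hx0).ne'
    have h3 := hval (Real.pi / x) x hω hx0 hx.2 (by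
      rw [abs_of_pos (div_pos Real.pi_pos hx0), div_div_cancel₀ Real.pi_pos.ne'])
    rw [h3.kernelFourier_eq, cexp_neg_I_mul_pi_div hx0, integral_cexp_pi_div hx0,
      integral_cexp_mul_div]
    simp only [norm_div, norm_mul, norm_pow, norm_neg, Complex.norm_real, Real.norm_eq_abs,
      abs_of_pos hx0, abs_of_pos hgx, RCLike.norm_ofNat]
    generalize ‖∫ u : ℝ, Complex.exp (Real.pi * Complex.I * u) *
      (((fwdDiff x)^[n] g (u * x) : ℝ) : ℂ)‖ = A
    field_simp

/-! ### Integration by parts, Karamata's theorem and asymptotics through the primitive -/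

/-- Integration by parts for the truncated Fourier integral of a locally integrable function. -/
theorem truncFourier_eq_of_primitive {ψ H : ℝ → ℝ} (hψ : LocallyIntegrable ψ)
    (hH : ∀ t, H t = H 0 + ∫ s in (0 : ℝ)..t, ψ s) (ω T : ℝ) :
    truncFourier ψ ω T = Complex.exp (Complex.I * ω * T) * H T
      - Complex.exp (Complex.I * ω * (-T : ℝ)) * H (-T) - Complex.I * ω * truncFourier H ω T := by
  have hii : ∀ a b, IntervalIntegrable ψ volume a b := fun a b =>
    intervalIntegrable_iff.2
      ((hψ.integrableOn_isCompact isCompact_uIcc).mono_set uIoc_subset_uIcc)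
  have hHfun : H = fun t => H 0 + ∫ s in (0 : ℝ)..t, ψ s := funext hH
  have hHc : Continuous H := by
    rw [hHfun]
    exact continuous_const.add (intervalIntegral.continuous_primitive hii 0)
  have hAC : AbsolutelyContinuousOnInterval H (-T) T := by
    rw [hHfun]
    refine AbsolutelyContinuousOnInterval.fun_add
      (ContDiffOn.absolutelyContinuousOnInterval contDiff_const.contDiffOn)
      ((hii (-T) T).absolutelyContinuousOnInterval_intervalIntegral ?_)
    rcases le_total 0 T with h | h
    · rw [uIcc_of_le (by linarith)]; exact ⟨by linarith, h⟩
    · rw [uIcc_of_ge (by linarith)]; exact ⟨h, by linarith⟩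
  -- By Lebesgue differentiation; as `H` is absolutely continuous, the almost everywhere derivative
  -- suffices for integration by parts.
  have hder : ∀ᵐ t, deriv H t = ψ t := by
    filter_upwards [LocallyIntegrable.ae_hasDerivAt_integral hψ] with t ht
    rw [hHfun]
    exact ((ht 0).const_add _).deriv
  have hparts : ∀ f f' : ℝ → ℝ, ContDiff ℝ 1 f → (∀ t, HasDerivAt f (f' t) t) →
      ∫ t in (-T)..T, f t * ψ t
        = f T * H T - f (-T) * H (-T) - ∫ t in (-T)..T, f' t * H t := by
    intro f f' hf hf'
    have h1 := AbsolutelyContinuousOnInterval.integral_mul_deriv_eq_deriv_mul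
      (hf.contDiffOn.absolutelyContinuousOnInterval (a := -T) (b := T)) hAC
    have h2 : deriv f = f' := funext fun t => (hf' t).deriv
    rw [h2] at h1
    rw [← h1]
    refine intervalIntegral.integral_congr_ae ?_
    filter_upwards [hder] with t ht _
    rw [ht]
  have hlin : ∀ t : ℝ, HasDerivAt (fun t : ℝ => ω * t) ω t := fun t => by
    simpa using (hasDerivAt_id t).const_mul ω
  have hcos := hparts (fun t => Real.cos (ω * t)) (fun t => -Real.sin (ω * t) * ω)
    (by fun_prop) (fun t => (hlin t).cos)
  have hsin := hparts (fun t => Real.sin (ω * t)) (fun t => Real.cos (ω * t) * ω)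
    (by fun_prop) (fun t => (hlin t).sin)
  have hexp : ∀ t : ℝ, Complex.exp (Complex.I * ω * t)
      = (Real.cos (ω * t) : ℂ) + Real.sin (ω * t) * Complex.I := fun t => by
    rw [show Complex.I * (ω : ℂ) * t = ((ω * t : ℝ) : ℂ) * Complex.I by push_cast; ring,
      Complex.exp_mul_I, Complex.ofReal_cos, Complex.ofReal_sin]
  have hsplit : ∀ φ : ℝ → ℝ, (∀ a b, IntervalIntegrable φ volume a b) →
      truncFourier φ ω T = ((∫ t in (-T)..T, Real.cos (ω * t) * φ t : ℝ) : ℂ)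
        + ((∫ t in (-T)..T, Real.sin (ω * t) * φ t : ℝ) : ℂ) * Complex.I := by
    intro φ hφ
    have i1 : IntervalIntegrable (fun t => Real.cos (ω * t) * φ t) volume (-T) T :=
      (hφ _ _).continuousOn_mul (by fun_prop)
    have i2 : IntervalIntegrable (fun t => Real.sin (ω * t) * φ t) volume (-T) T :=
      (hφ _ _).continuousOn_mul (by fun_prop)
    have j1 : IntervalIntegrable (fun t => ((Real.cos (ω * t) * φ t : ℝ) : ℂ)) volume (-T) T :=
      ⟨i1.1.ofReal, i1.2.ofReal⟩
    have j2 : IntervalIntegrable (fun t => ((Real.sin (ω * t) * φ t : ℝ) : ℂ)) volume (-T) T :=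
      ⟨i2.1.ofReal, i2.2.ofReal⟩
    rw [← intervalIntegral.integral_ofReal, ← intervalIntegral.integral_ofReal,
      ← intervalIntegral.integral_mul_const, ← intervalIntegral.integral_add j1
        (j2.mul_const _), truncFourier]
    refine intervalIntegral.integral_congr fun t _ => ?_
    simp only [hexp]
    push_cast; ring
  have e1 : ∫ t in (-T)..T, -Real.sin (ω * t) * ω * H t
      = -ω * ∫ t in (-T)..T, Real.sin (ω * t) * H t := by
    rw [← intervalIntegral.integral_const_mul]
    refine intervalIntegral.integral_congr fun t _ => ?_
    ring
  have e2 : ∫ t in (-T)..T, Real.cos (ω * t) * ω * H t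
      = ω * ∫ t in (-T)..T, Real.cos (ω * t) * H t := by
    rw [← intervalIntegral.integral_const_mul]
    refine intervalIntegral.integral_congr fun t _ => ?_
    ring
  rw [hsplit ψ hii, hsplit H fun a b => hHc.intervalIntegrable a b, hexp, hexp, hcos, hsin, e1, e2]
  push_cast
  linear_combination (∫ t in (-T)..T, Real.sin (ω * t) * H t : ℝ) * ω * Complex.I_mul_I

theorem LocallyIntegrable.intervalIntegrable_real {g : ℝ → ℝ} (hg : LocallyIntegrable g) (a b : ℝ) :
    IntervalIntegrable g volume a b :=
  intervalIntegrable_iff.2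
    ((hg.integrableOn_isCompact isCompact_uIcc).mono_set uIoc_subset_uIcc)

theorem intervalIntegral_eq_zero_of_nonpos {g : ℝ → ℝ} (hz : ∀ t ≤ 0, g t = 0) {t : ℝ}
    (ht : t ≤ 0) : ∫ s in (0 : ℝ)..t, g s = 0 := by
  rw [intervalIntegral.integral_congr (g := fun _ => (0 : ℝ)), intervalIntegral.integral_zero]
  intro s hs
  rw [uIcc_of_ge ht] at hs
  exact hz s hs.2

/-- Karamata's theorem: the primitive of a regularly varying function. -/
theorem RegVarAtZero.tendsto_primitive_div {g : ℝ → ℝ} {ρ : ℝ} (hg : RegVarAtZero g ρ)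
    (hρ : -1 < ρ) (hloc : LocallyIntegrable g) :
    Tendsto (fun x => (∫ s in (0 : ℝ)..x, g s) / (x * g x)) (𝓝[>] 0) (𝓝 (1 / (ρ + 1))) := by
  set ε : ℝ := (ρ + 1) / 2 with hε
  have hε0 : 0 < ε := by rw [hε]; linarith
  obtain ⟨δ, C, hδ, hC, hpot⟩ := hg.potter hε0
  have hint : ∫ u in (0 : ℝ)..1, u ^ ρ = 1 / (ρ + 1) := by
    rw [integral_rpow (Or.inl hρ), Real.one_rpow, Real.zero_rpow (by linarith), sub_zero]
  rw [← hint]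
  have hlim : Tendsto (fun x => ∫ u in (0 : ℝ)..1, g (u * x) / g x) (𝓝[>] 0)
      (𝓝 (∫ u in (0 : ℝ)..1, u ^ ρ)) := by
    refine intervalIntegral.tendsto_integral_filter_of_dominated_convergence
      (fun u => C * (u ^ (ρ - ε) + u ^ (ρ + ε))) ?_ ?_ ?_ ?_
    · filter_upwards [self_mem_nhdsWithin] with x hx
      exact ((aestronglyMeasurable_comp_mul_right hloc.aestronglyMeasurable
        (ne_of_gt hx)).mul_const (g x)⁻¹).restrict
    · filter_upwards [Ioc_mem_nhdsGT hδ] with x hx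
      refine Eventually.of_forall fun u hu => ?_
      rw [uIoc_of_le zero_le_one] at hu
      have hux : u * x ≤ δ := by nlinarith [hu.1, hu.2, hx.1, hx.2]
      have hux0 : 0 < u * x := mul_pos hu.1 hx.1
      have h1 := hpot x (u * x) hx.1 hx.2 hux0 hux
      have h2 := (hpot (u * x) x hux0 hux hx.1 hx.2).1
      rw [Real.norm_of_nonneg (div_pos h2 h1.1).le, div_le_iff₀ h1.1]
      rw [mul_div_cancel_right₀ _ hx.1.ne'] at h1
      exact h1.2
    · exact ((intervalIntegral.intervalIntegrable_rpow' (by rw [hε]; linarith)).add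
        (intervalIntegral.intervalIntegrable_rpow' (by linarith))).const_mul C
    · refine Eventually.of_forall fun u hu => ?_
      rw [uIoc_of_le zero_le_one] at hu
      exact hg.tendsto_ratio hu.1
  refine hlim.congr' ?_
  filter_upwards [self_mem_nhdsWithin] with x hx
  have hx0 : x ≠ 0 := ne_of_gt hx
  have h3 := intervalIntegral.mul_integral_comp_mul_right (a := 0) (b := 1) (f := g) (c := x)
  rw [zero_mul, one_mul] at h3
  rw [intervalIntegral.integral_div, ← h3, mul_div_mul_left _ _ hx0]

/-- The primitive of a function that is regularly varying at zero with index `ρ > -1` is regularly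
varying with index `ρ + 1`. -/
theorem RegVarAtZero.primitive {g : ℝ → ℝ} {ρ : ℝ} (hg : RegVarAtZero g ρ)
    (hρ : -1 < ρ) (hloc : LocallyIntegrable g) :
    RegVarAtZero (fun x => ∫ s in (0 : ℝ)..x, g s) (ρ + 1) := by
  set H : ℝ → ℝ := fun x => ∫ s in (0 : ℝ)..x, g s with hH
  have hHc : Continuous H :=
    intervalIntegral.continuous_primitive (LocallyIntegrable.intervalIntegrable_real hloc) 0
  have hk := hg.tendsto_primitive_div hρ hloc
  have hρ1 : 0 < 1 / (ρ + 1) := one_div_pos.2 (by linarith)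
  have hpos : ∀ᶠ x in 𝓝[>] (0 : ℝ), 0 < H x := by
    filter_upwards [hk.eventually_const_lt hρ1, hg.eventually_pos, self_mem_nhdsWithin]
      with x h1 h2 h3
    exact (div_pos_iff_of_pos_right (mul_pos h3 h2)).1 h1
  have hratio : ∀ l : ℝ, 0 < l →
      Tendsto (fun x => H (l * x) / H x) (𝓝[>] 0) (𝓝 (l ^ (ρ + 1))) := by
    intro l hl
    have hml : Tendsto (fun x : ℝ => l * x) (𝓝[>] 0) (𝓝[>] 0) := by
      refine tendsto_nhdsWithin_iff.2 ⟨?_, ?_⟩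
      · have : Tendsto (fun x : ℝ => l * x) (𝓝 0) (𝓝 (l * 0)) := (continuous_const_mul l).tendsto 0
        rw [mul_zero] at this
        exact this.mono_left nhdsWithin_le_nhds
      · filter_upwards [self_mem_nhdsWithin] with x hx using mul_pos hl hx
    -- Karamata's limit at `l x` and at `x` cancels, so `H (l x) / H x` behaves like `l g (l x) / g
    -- x`.
    have h1 := (((hk.comp hml).div hk hρ1.ne').mul (hg.tendsto_ratio hl)).mul_const l
    rw [div_self hρ1.ne', one_mul, ← Real.rpow_add_one hl.ne'] at h1
    refine h1.congr' ?_
    filter_upwards [hpos, hg.eventually_pos, hml.eventually hg.eventually_pos,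
      self_mem_nhdsWithin] with x h2 h3 h4 h5
    have h5' : x ≠ 0 := ne_of_gt h5
    change H (l * x) / (l * x * g (l * x)) / (H x / (x * g x)) * (g (l * x) / g x) * l = _
    field_simp
  refine ⟨?_, ?_, ?_⟩
  · exact (hHc.measurable.comp (measurable_const.div measurable_id)).aemeasurable
  · have := tendsto_inv_atTop_nhdsGT_zero.eventually hpos
    simpa using this
  · intro l hl
    have := (hratio l⁻¹ (inv_pos.2 hl)).comp tendsto_inv_atTop_nhdsGT_zero
    rw [Real.inv_rpow hl.le, ← Real.rpow_neg hl.le] at this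
    refine this.congr fun x => ?_
    simp [Function.comp, mul_comm]

/-- The additive constant `a` allows a second application: the first difference of a primitive is
again a primitive, but only up to a constant. -/
theorem fwdDiff_primitive {g : ℝ → ℝ} (hg : LocallyIntegrable g) (a x t : ℝ) :
    fwdDiff x (fun t => a + ∫ s in (0 : ℝ)..t, g s) t
      = fwdDiff x (fun t => a + ∫ s in (0 : ℝ)..t, g s) 0 + ∫ s in (0 : ℝ)..t, fwdDiff x g s := by
  have hi := LocallyIntegrable.intervalIntegrable_real hg
  have hi' := LocallyIntegrable.intervalIntegrable_real (locallyIntegrable_comp_add_right hg x)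
  simp only [fwdDiff]
  rw [intervalIntegral.integral_sub (hi' 0 t) (hi 0 t), intervalIntegral.integral_comp_add_right,
    ← intervalIntegral.integral_add_adjacent_intervals (hi 0 (0 + x)) (hi (0 + x) (t + x))]
  simp
  ring

theorem fwdDiff_primitive_eq_integral {g : ℝ → ℝ} (hg : LocallyIntegrable g) (a x t : ℝ) :
    fwdDiff x (fun t => a + ∫ s in (0 : ℝ)..t, g s) t = ∫ s in t..(t + x), g s := by
  have hi := LocallyIntegrable.intervalIntegrable_real hg
  simp only [fwdDiff]
  rw [← intervalIntegral.integral_add_adjacent_intervals (hi 0 t) (hi t (t + x))]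
  ring

/-- The truncated Fourier integrals of the second difference of a square integrable function, in
terms of its primitive. -/
theorem hasFourierValue_fwdDiff_of_primitive {g : ℝ → ℝ} (h2 : MemLp g 2 volume) {x : ℝ}
    (hi : Integrable ((fwdDiff x)^[2] (fun t => ∫ s in (0 : ℝ)..t, g s))) (ω : ℝ) :
    HasFourierValue ((fwdDiff x)^[2] g) ω (-(Complex.I * ω * ∫ t : ℝ,
      Complex.exp (Complex.I * ω * (t : ℂ)) *
        (((fwdDiff x)^[2] (fun t => ∫ s in (0 : ℝ)..t, g s) t : ℝ) : ℂ))) := by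
  have hloc : LocallyIntegrable g := h2.locallyIntegrable (by norm_num)
  set G : ℝ → ℝ := fun t => ∫ s in (0 : ℝ)..t, g s with hG
  set D := fwdDiff x g with hD
  have hD2 : MemLp D 2 volume := memLp_fwdDiff h2 x
  have hDloc : LocallyIntegrable D := hD2.locallyIntegrable (by norm_num)
  set E := fwdDiff x D with hE
  have hEloc : LocallyIntegrable E := (memLp_fwdDiff hD2 x).locallyIntegrable (by norm_num)
  have e1 : fwdDiff x G = fun t => fwdDiff x G 0 + ∫ s in (0 : ℝ)..t, D s := by
    funext t
    have := fwdDiff_primitive hloc 0 x t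
    simp only [zero_add] at this
    exact this
  set H := fwdDiff x (fwdDiff x G) with hH
  have hHprim : ∀ t, H t = H 0 + ∫ s in (0 : ℝ)..t, E s := fun t => by
    rw [hH, e1]; exact fwdDiff_primitive hDloc _ x t
  have hHwin : ∀ t, H t = ∫ s in t..(t + x), D s := fun t => by
    rw [hH, e1]; exact fwdDiff_primitive_eq_integral hDloc _ x t
  -- The second difference of the primitive is a window integral of an `L²` function, so the
  -- boundary terms of the integration by parts vanish.
  have hH0 : Tendsto H (cocompact ℝ) (𝓝 0) := by
    refine squeeze_zero_norm (fun t => ?_)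
      (tendsto_integral_window_of_memLp_two hD2 x le_rfl)
    rw [hHwin]
    exact intervalIntegral.norm_integral_le_integral_norm_uIoc
  have hbd : ∀ {u : ℝ → ℝ}, Tendsto u atTop (cocompact ℝ) →
      Tendsto (fun T : ℝ => Complex.exp (Complex.I * ω * (u T : ℂ)) * H (u T)) atTop (𝓝 0) := by
    intro u hu
    refine squeeze_zero_norm (fun T => ?_) (by simpa using (hH0.comp hu).norm)
    rw [norm_mul, norm_cexp_I_mul, one_mul, Complex.norm_real]
    rfl
  have hb1 := hbd (u := id) (tendsto_id'.2 atTop_le_cocompact)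
  have hb2 := hbd (u := fun T => -T) (tendsto_neg_atTop_atBot.mono_right atBot_le_cocompact)
  have hv := (hasFourierValue_of_integrable hi ω).const_mul (Complex.I * ω)
  have := (hb1.sub hb2).sub hv
  rw [sub_zero, zero_sub] at this
  exact this.congr fun T => (truncFourier_eq_of_primitive hEloc hHprim ω T).symm

/-- Existence of the Fourier transform and its behaviour at infinity for a regularly varying kernel
whose primitive has dominated second differences. -/
theorem RegVarAtZero.fourier_asymptotics_of_primitive {g : ℝ → ℝ} {ρ : ℝ} (hg : RegVarAtZero g ρ)
    (hρ : -1 < ρ) (h2 : MemLp g 2 volume) (hz : ∀ t ≤ 0, g t = 0)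
    {Q : ℝ → ℝ} (hQ : IntegrableOn Q (Ici 1)) {δ : ℝ} (hδ : 0 < δ)
    (hdom : ∀ x, 0 < x → x ≤ δ → ∀ u, 1 ≤ u →
      |(fwdDiff x)^[2] (fun t => ∫ s in (0 : ℝ)..t, g s) (u * x)|
        ≤ (∫ s in (0 : ℝ)..x, g s) * Q u) :
    (∀ ω : ℝ, ω ≠ 0 → HasFourierValue g ω (kernelFourier g ω)) ∧
    ∃ c : ℝ, 0 < c ∧ Tendsto (fun x : ℝ => ‖kernelFourier g ((Real.pi / x : ℝ) : ℂ)‖ / (x * g x))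
      (𝓝[>] 0) (𝓝 c) := by
  have hloc : LocallyIntegrable g := h2.locallyIntegrable (by norm_num)
  have hGrv := hg.primitive hρ hloc
  have hkar := hg.tendsto_primitive_div hρ hloc
  have hG0 : ∀ t ≤ 0, (∫ s in (0 : ℝ)..t, g s) = 0 := fun t ht =>
    intervalIntegral_eq_zero_of_nonpos hz ht
  have hGc : Continuous (fun t => ∫ s in (0 : ℝ)..t, g s) :=
    intervalIntegral.continuous_primitive (LocallyIntegrable.intervalIntegrable_real hloc) 0
  set G : ℝ → ℝ := fun t => ∫ s in (0 : ℝ)..t, g s with hG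
  have hval : ∀ ω x : ℝ, ω ≠ 0 → 0 < x → x ≤ δ → x ≤ Real.pi / |ω| → HasFourierValue g ω
      (-(Complex.I * ω * ∫ t : ℝ, Complex.exp (Complex.I * ω * (t : ℂ)) *
          (((fwdDiff x)^[2] G t : ℝ) : ℂ))
        / (Complex.exp (-(Complex.I * ω * x)) - 1) ^ 2) := fun ω x hω hx hxδ hxω =>
    hasFourierValue_of_fwdDiff_iterate h2 (cexp_sub_one_ne_zero hω hx hxω) 2
      (hasFourierValue_fwdDiff_of_primitive h2
        (integrable_fwdDiff_iterate hGc.locallyIntegrable hG0 hQ hx (hdom x hx hxδ)) ω)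
  constructor
  · intro ω hω
    have hx : 0 < min δ (Real.pi / |ω|) := lt_min hδ (div_pos Real.pi_pos (abs_pos.2 hω))
    have h3 := hval ω _ hω hx (min_le_left _ _) (min_le_right _ _)
    rw [h3.kernelFourier_eq]
    exact h3
  · obtain ⟨hKi, hK⟩ := hGrv.tendsto_integral_fwdDiff (by linarith) hG0
      hGc.aestronglyMeasurable 2 hQ hδ hdom
    have hK0 := integral_cexp_mul_fwdDiff_posPow_ne_zero (ρ := ρ + 1) (by linarith) 2 hKi
    -- The factor `π / 4` combines the frequency `π / x` from the integration by parts with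
    -- `(-2)^2`; the factor `1 / (ρ + 1)` is Karamata's limit of `G x / (x g x)`.
    refine ⟨_, mul_pos (mul_pos (norm_pos_iff.2 hK0) (div_pos Real.pi_pos four_pos))
      (one_div_pos.2 (by linarith : 0 < ρ + 1)), ?_⟩
    refine ((hK.norm.mul_const (Real.pi / 4)).mul hkar).congr' ?_
    filter_upwards [Ioc_mem_nhdsGT hδ, hg.eventually_pos, hGrv.eventually_pos] with x hx hgx hGx
    have hx0 : 0 < x := hx.1
    have hω : Real.pi / x ≠ 0 := (div_pos Real.pi_pos hx0).ne'
    have h3 := hval (Real.pi / x) x hω hx0 hx.2 (by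
      rw [abs_of_pos (div_pos Real.pi_pos hx0), div_div_cancel₀ Real.pi_pos.ne'])
    rw [h3.kernelFourier_eq, cexp_neg_I_mul_pi_div hx0, integral_cexp_pi_div hx0,
      integral_cexp_mul_div]
    simp only [norm_div, norm_mul, norm_pow, norm_neg, Complex.norm_real, Real.norm_eq_abs,
      abs_of_pos hx0, abs_of_pos hGx, RCLike.norm_ofNat, Complex.norm_I,
      abs_of_pos Real.pi_pos]
    generalize ‖∫ u : ℝ, Complex.exp (Real.pi * Complex.I * u) *
      (((fwdDiff x)^[2] G (u * x) : ℝ) : ℂ)‖ = A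
    have hGx' : 0 < G x := hGx
    change A / G x * (Real.pi / 4) * (G x / (x * g x)) = _
    field_simp
    norm_num

/-! ### The two cases, regular variation of the spectral density, and the conclusion -/

/-- Domination of the second differences of an eventually positive function. -/
theorem SecondDiffCondition.exists_dominating_of_eventually_pos {h : ℝ → ℝ}
    (hh : SecondDiffCondition h) (hpos : ∀ᶠ x in 𝓝[>] (0 : ℝ), 0 < h x) :
    ∃ (δ : ℝ) (Q : ℝ → ℝ), 0 < δ ∧ IntegrableOn Q (Ici 1) ∧
      ∀ x, 0 < x → x ≤ δ → ∀ u, 1 ≤ u → |(fwdDiff x)^[2] h (u * x)| ≤ h x * Q u := by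
  obtain ⟨x₀, Q, hx₀, hQ, hdom⟩ := hh.exists_dominating
  obtain ⟨η, hη, hηs⟩ := mem_nhdsGT_iff_exists_Ioc_subset.1 hpos
  refine ⟨min x₀ η, Q, lt_min hx₀ hη, hQ, fun x hx hxx u hu => ?_⟩
  have h1 := hdom x hx (hxx.trans (min_le_left _ _)) u hu
  have h2 : 0 < h x := hηs ⟨hx, hxx.trans (min_le_right _ _)⟩
  rwa [abs_of_pos h2] at h1

/-- The Fourier transform of a kernel under the assumptions on its derivatives. -/
theorem fourier_asymptotics_of_kernelDeriv {g : ℝ → ℝ} {ν : ℝ} (h2 : MemLp g 2 volume)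
    (hz : ∀ t ≤ 0, g t = 0) (hν : 1 / 2 < ν) (hgν : RegVarAtZero g (ν - 1))
    (hderiv : ∀ t : ℝ, 0 < t → HasDerivsAt g ⌊ν - 1⌋ t)
    (hA2 : ∃ α : ℝ, 0 ≤ α ∧ α < 1 ∧ RegVarAtZero (kernelDeriv g ⌊ν - 1⌋) α)
    (hA3 : SecondDiffCondition (kernelDeriv g ⌊ν - 1⌋)) :
    (∀ ω : ℝ, ω ≠ 0 → HasFourierValue g ω (kernelFourier g ω)) ∧
    ∃ c : ℝ, 0 < c ∧ Tendsto (fun x : ℝ => ‖kernelFourier g ((Real.pi / x : ℝ) : ℂ)‖ / (x * g x))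
      (𝓝[>] 0) (𝓝 c) := by
  obtain ⟨α, hα0, -, hα⟩ := hA2
  have hpos := hα.eventually_pos
  -- For `ν < 1` the function in (A3) is the primitive of `g`; for `ν ≥ 1` it is a derivative of
  -- order `k ≥ 0`.
  rcases lt_or_ge ⌊ν - 1⌋ 0 with hneg | hnn
  · have hfun : kernelDeriv g ⌊ν - 1⌋ = fun t => ∫ s in (0 : ℝ)..t, g s := by
      funext t; exact if_pos hneg
    rw [hfun] at hA3 hpos
    obtain ⟨δ, Q, hδ, hQ, hdom⟩ := hA3.exists_dominating_of_eventually_pos hpos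
    exact hgν.fourier_asymptotics_of_primitive (by linarith) h2 hz hQ hδ hdom
  · obtain ⟨k, hk⟩ := Int.eq_ofNat_of_zero_le hnn
    have hfun : kernelDeriv g ⌊ν - 1⌋ = iteratedDeriv k g := by
      funext t; simp [kernelDeriv, hk]
    rw [hfun] at hA3 hα
    rw [hk] at hderiv
    obtain ⟨x₀, Q, hx₀, hQ, hdom⟩ := hA3.exists_dominating
    obtain ⟨R, hR, hRdom⟩ := exists_dominating_fwdDiff hderiv hQ hdom
    obtain ⟨C, hC, hCev⟩ := eventually_pow_mul_iteratedDeriv_le hderiv hgν hz hα0 hα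
    obtain ⟨η, hη, hηs⟩ := mem_nhdsGT_iff_exists_Ioc_subset.1 hCev
    refine hgν.fourier_asymptotics (by linarith) h2 hz (n := k + 2) (hR.norm.const_mul C)
      (lt_min hx₀ hη) fun x hx hxx u hu => ?_
    have h1 := hRdom x hx (hxx.trans (min_le_left _ _)) u hu
    have h3 : x ^ k * |iteratedDeriv k g x| ≤ C * g x := hηs ⟨hx, hxx.trans (min_le_right _ _)⟩
    refine h1.trans ?_
    calc x ^ k * |iteratedDeriv k g x| * R u ≤ x ^ k * |iteratedDeriv k g x| * ‖R u‖ :=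
          mul_le_mul_of_nonneg_left (Real.le_norm_self _) (by positivity)
      _ ≤ C * g x * ‖R u‖ := mul_le_mul_of_nonneg_right h3 (norm_nonneg _)
      _ = g x * (C * ‖R u‖) := by ring

/-- Measurability is read off from the integrability of the squared modulus in Parseval's identity.
-/
theorem aemeasurable_cmaSpectralDensity {g : ℝ → ℝ} (h2 : MemLp g 2 volume)
    (hF : ∀ ω : ℝ, ω ≠ 0 → HasFourierValue g ω (kernelFourier g ω)) (σ : ℝ) :
    AEMeasurable (cmaSpectralDensity σ g) volume :=
  ((integral_mul_comp_add_eq h2 hF).1.aestronglyMeasurable.aemeasurable).const_mul _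

/-- Regular variation of the spectral density at infinity. -/
theorem regVarAtTop_cmaSpectralDensity {g : ℝ → ℝ} {ν σ : ℝ} (hσ : 0 < σ)
    (h2 : MemLp g 2 volume) (hgν : RegVarAtZero g (ν - 1))
    (hF : ∀ ω : ℝ, ω ≠ 0 → HasFourierValue g ω (kernelFourier g ω)) {c : ℝ} (hc : 0 < c)
    (hlim : Tendsto (fun x : ℝ => ‖kernelFourier g ((Real.pi / x : ℝ) : ℂ)‖ / (x * g x))
      (𝓝[>] 0) (𝓝 c)) :
    RegVarAtTop (fun x : ℝ => cmaSpectralDensity σ g |x|) (-2 * ν) := by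
  have hpi : Tendsto (fun ω : ℝ => Real.pi / ω) atTop (𝓝[>] 0) := by
    refine tendsto_nhdsWithin_iff.2 ⟨tendsto_const_nhds.div_atTop tendsto_id, ?_⟩
    filter_upwards [eventually_gt_atTop 0] with ω hω using div_pos Real.pi_pos hω
  set N : ℝ → ℝ := fun ω => ‖kernelFourier g (ω : ℂ)‖ with hN
  set a : ℝ → ℝ := fun ω => Real.pi / ω * g (Real.pi / ω) with ha
  have hNa : Tendsto (fun ω => N ω / a ω) atTop (𝓝 c) := by
    refine (hlim.comp hpi).congr fun ω => ?_
    simp only [Function.comp, hN, ha]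
    rw [div_div_cancel₀ Real.pi_pos.ne']
  have hapos : ∀ᶠ ω in atTop, 0 < a ω := by
    filter_upwards [hpi.eventually hgν.eventually_pos, eventually_gt_atTop 0] with ω h1 h3
    exact mul_pos (div_pos Real.pi_pos h3) h1
  have hNpos : ∀ᶠ ω in atTop, 0 < N ω := by
    filter_upwards [hNa.eventually_const_lt hc, hapos] with ω h1 h3
    exact (div_pos_iff_of_pos_right h3).1 h1
  have hk : 0 < σ ^ 2 / (2 * Real.pi) := by positivity
  refine ⟨?_, ?_, ?_⟩
  · refine (aemeasurable_cmaSpectralDensity h2 hF σ).restrict.congr ?_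
    filter_upwards [ae_restrict_mem measurableSet_Ioi] with x hx
    rw [abs_of_pos hx]
  · filter_upwards [hNpos, eventually_gt_atTop 0] with ω h1 h3
    rw [abs_of_pos h3]
    exact mul_pos hk (pow_pos h1 2)
  · intro l hl
    have hml : Tendsto (fun ω : ℝ => l * ω) atTop atTop := tendsto_id.const_mul_atTop hl
    have h1 := (hNa.comp hml).div hNa hc.ne'
    have h3 := (hgν.tendsto_ratio (inv_pos.2 hl)).comp hpi
    -- The ratio of transforms is compared with the ratio of `x g x` at `x = π / ω`; scaling `ω` by
    -- `l` scales `x` by `l⁻¹`, which gives `(l⁻¹)^ν` before squaring.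
    have h4 := ((h1.mul (h3.mul_const l⁻¹)).pow 2)
    rw [div_self hc.ne', one_mul, ← Real.rpow_add_one (inv_pos.2 hl).ne', sub_add_cancel,
      Real.inv_rpow hl.le, ← Real.rpow_neg hl.le, ← Real.rpow_natCast, ← Real.rpow_mul hl.le] at h4
    rw [show -2 * ν = -ν * ((2 : ℕ) : ℝ) by push_cast; ring]
    refine h4.congr' ?_
    filter_upwards [hNpos, hapos, hml.eventually hapos, eventually_gt_atTop 0] with ω h5 h6 h7 h8
    simp only [Function.comp, cmaSpectralDensity]
    rw [abs_of_pos h8, abs_of_pos (mul_pos hl h8)]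
    have e1 : l⁻¹ * (Real.pi / ω) = Real.pi / (l * ω) := by field_simp
    have e2 : g (l⁻¹ * (Real.pi / ω)) / g (Real.pi / ω) * l⁻¹ = a (l * ω) / a ω := by
      have h9 : g (Real.pi / ω) ≠ 0 := right_ne_zero_of_mul h6.ne'
      simp only [ha]
      rw [e1]
      have := Real.pi_pos.ne'
      field_simp
    rw [e2]
    change (N (l * ω) / a (l * ω) / (N ω / a ω) * (a (l * ω) / a ω)) ^ 2
      = σ ^ 2 / (2 * Real.pi) * N (l * ω) ^ 2 / (σ ^ 2 / (2 * Real.pi) * N ω ^ 2)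
    rw [mul_div_mul_left _ _ hk.ne', ← div_pow]
    congr 1
    field_simp

theorem proposition6p4 {Ω : Type*} [MeasurableSpace Ω] (P : Measure Ω) [IsProbabilityMeasure P]
    (L Y : ℝ → Ω → ℝ) (σ : ℝ) (hσ : 0 < σ) (hL : IsOrthogonalNoise P L σ)
    (g : ℝ → ℝ) (hg : IsCMAKernel g) (hY : IsCMAProcess P L g Y)
    (ν : ℝ) (hν : 1 / 2 < ν) (hgν : RegVarAtZero g (ν - 1))
    (hderiv : ∀ t : ℝ, 0 < t → HasDerivsAt g ⌊ν - 1⌋ t)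
    (hA1 : NonzeroDerivAtZero g ⌊ν⌋)
    (hA2 : ∃ α : ℝ, 0 ≤ α ∧ α < 1 ∧ RegVarAtZero (kernelDeriv g ⌊ν - 1⌋) α)
    (hA3 : SecondDiffCondition (kernelDeriv g ⌊ν - 1⌋)) :
    (∀ ω : ℝ, ω ≠ 0 → HasFourierValue g (ω : ℂ) (kernelFourier g (ω : ℂ))) ∧
    IsSpectralDensity P Y (cmaSpectralDensity σ g) ∧
    (∀ ω : ℝ, ω ≠ 0 → 0 < cmaSpectralDensity σ g ω) ∧
    RegVarAtTop (fun x : ℝ => cmaSpectralDensity σ g |x|) (-2 * ν) := by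
  obtain ⟨hF, c, hc, hlim⟩ :=
    fourier_asymptotics_of_kernelDeriv hg.memLp hg.causal hν hgν hderiv hA2 hA3
  refine ⟨hF, hY.isSpectralDensity hL hg.memLp hF, fun ω hω => ?_,
    regVarAtTop_cmaSpectralDensity hσ hg.memLp hgν hF hc hlim⟩
  -- Minimum phase only excludes zeros where the Fourier integral converges, so the convergence just
  -- obtained is needed here.
  have hne : kernelFourier g (ω : ℂ) ≠ 0 := fun h0 =>
    hg.minimum_phase ω (by simp) (h0 ▸ hF ω hω)
  unfold cmaSpectralDensity
  positivity
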